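/- Let $(R,\mathfrak m)$ be a commutative Noetherian local ring. An $R$-module $M$ is called *Ext-finite* if $\operatorname{Ext}^i_R(N,M)$ is a finitely generated $R$-module for every finitely generated $R$-module $N$ and every $i\ge 1$. A *bounded quasi-injective resolution* of an $R$-module $M$ is a bounded complex $I=(\cdots\to I_{i+1}\to I_i\to I_{i-1}\to\cdots)$ of injective $R$-modules such that $H_i(I)\cong M^{\oplus b_i}$ for all $i$, with non-negative integers $b_i$ that are not all zero. The *quasi-injective dimension* of a non-zero $R$-module $M$ is $$\operatorname{qid}_R M=\inf\{\,\operatorname{hinf} I-\inf I : I \text{ is a bounded quasi-injective resolution of } M\,\},$$ where $\operatorname{hinf} I=\inf\{i: H_i(I)\ne 0\}$ and $\inf I=\inf\{i: I_i\neq 0\}$ (so $\operatorname{qid}_RM=\infty$ if $M$ has no bounded quasi-injective resolution), and $\operatorname{qid}_R 0=-\infty$. If $$0\to M\xrightarrow{d^{-1}}E^0(M)\xrightarrow{d^0}E^1(M)\xrightarrow{d^1}\cdots$$ is the augmented minimal injective resolution of $M$, the *$n$-th cosyzygy* of $M$ is $\Omega_{-n}^R M=\operatorname{Im}(d^{n-1})$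 for $n\ge 0$. Let $M$ be a non-zero Ext-finite $R$-module with $\operatorname{qid}_R M<\infty$. Then: 1. If $y\in\mathfrak m$ is a non-zero-divisor on $R$ and on $M$, and $M\neq yM$, then $$\operatorname{qid}_{R/(y)} (M/yM)=\max\{\operatorname{qid}_R M-1,\,0\}.$$ 2. For every $n\ge 0$ with $\Omega_{-n}^R M\neq 0$, $$\operatorname{qid}_R(\Omega_{-n}^R M)=\max\{\operatorname{qid}_R M-n,\,0\}.$$ -/

import Mathlib

open CategoryTheory

universe u

section

variable (R : Type u) [CommRing R] (M : Type u) [AddCommGroup M] [Module R M]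

/-- An `R`-module `M` is Ext-finite if `Ext^i_R(N, M)` is a finitely generated `R`-module for every
finitely generated `R`-module `N` and every `i ≥ 1`. -/
def ExtFinite : Prop :=
  ∀ (N : Type u) [AddCommGroup N] [Module R N] [Module.Finite R N] (i : ℕ), 1 ≤ i →
    Module.Finite R (Abelian.Ext (ModuleCat.of R N) (ModuleCat.of R M) i)

/-- A quasi-injective resolution of `M`: a bounded above complex `I` (with differentials
`I_i → I_{i-1}`) of injective `R`-modules with `H_i(I) ≅ M^{⊕ b_i}` for non-negative integers
`b_i` that are not all zero. (Above the supremum of `I` the homology is zero, so that requiring the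
isomorphisms for all `i` only forces `b_i = 0` there when `M` is non-zero.) -/
structure IsQuasiInjectiveResolution (I : ChainComplex (ModuleCat.{u} R) ℤ) : Prop where
  boundedAbove : ∃ c : ℤ, ∀ i : ℤ, c < i → Limits.IsZero (I.X i)
  injective : ∀ i : ℤ, Injective (I.X i)
  homology_equiv : ∃ b : ℤ → ℕ, (∃ i, b i ≠ 0) ∧
    ∀ i : ℤ, Nonempty (I.homology i ≃ₗ[R] (Fin (b i) → M))

/-- A bounded quasi-injective resolution of `M`. -/
structure IsBoundedQuasiInjectiveResolution (I : ChainComplex (ModuleCat.{u} R) ℤ) : Prop extends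
    IsQuasiInjectiveResolution R M I where
  boundedBelow : ∃ c : ℤ, ∀ i : ℤ, i < c → Limits.IsZero (I.X i)

open Classical in
/-- The quasi-injective dimension of `M`: it is `-∞` if `M = 0`, and otherwise the infimum of
`hinf I - inf I` over the bounded quasi-injective resolutions `I` of `M`, where
`hinf I = inf {i | H_i(I) ≠ 0}` and `inf I = inf {i | I_i ≠ 0}` (both are attained for such `I`).
The infimum is `∞` if there is no bounded quasi-injective resolution. -/
noncomputable def qid : EReal :=
  if Subsingleton M then ⊥
  else sInf {d : EReal | ∃ (I : ChainComplex (ModuleCat.{u} R) ℤ) (h a : ℤ),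
    IsBoundedQuasiInjectiveResolution R M I ∧
    IsLeast {i : ℤ | ¬ Limits.IsZero (I.homology i)} h ∧
    IsLeast {i : ℤ | ¬ Limits.IsZero (I.X i)} a ∧
    d = (((h - a : ℤ) : ℝ) : EReal)}

end

section

variable {R : Type u} [CommRing R] {X : ModuleCat.{u} R}

/-- The `n`-th module `Im(d^{n-1})` attached to an augmented injective resolution
`0 → X → J^0 → J^1 → ⋯`, as a submodule of `J^n`; here `d^{-1} : X → J^0` is the augmentation. -/
noncomputable def cosyzygy (J : InjectiveResolution X) : (n : ℕ) → Submodule R (J.cocomplex.X n)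
  | 0 => LinearMap.range (J.ι.f 0).hom
  | n + 1 => LinearMap.range (J.cocomplex.d n (n + 1)).hom

/-- An injective resolution is minimal if each `J^n` is an injective envelope of
`Im(d^{n-1})`, i.e. (as `J^n` is injective) an essential extension of this submodule. -/
def IsMinimalInjectiveResolution (J : InjectiveResolution X) : Prop :=
  ∀ (n : ℕ) (S : Submodule R (J.cocomplex.X n)), S ⊓ cosyzygy J n = ⊥ → S = ⊥

end

/-! Write `k` for the quasi-injective dimension of `M`. Upper bounds come from explicit complexes
built from a resolution `I` of `M`. The complex `Hom_R(R/(y), I)` has homology `(M/yM)^{b_{i+1}}` in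
degree `i` (`IsQIR.torsion`). If `0 → M → E → C → 0` is exact with `E` injective, the shifted cone
of a map from `I` to the `E^{b_i}` has homology `C^{b_{i+1}}` (`IsQIR.exists_coneZero`). Both lower
the bottom homology by one degree.

Lower bounds come from Ext. Let `F` have finite projective dimension and contain the residue field;
such an `F` is `R/J` with `J` from `exists_ideal_extZero_residue`. The top `s` with `Ext^s(F, M) ≠
0` is at most the length of any resolution (`HasQIR.le_of_not_extZero`), and equals `k` when `k > 0`
and `M` is Ext-finite (`not_extZero_of_minimal`). Indeed, let `Z` be the cycles in the degree of the
lowest homology; `Z` has injective dimension at most `k`. If `Ext^k(F, M)` vanished, then so would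
`Ext^k(F, Z)`, hence `Ext^k` of the residue field into `Z`, and by Nakayama `Ext^k(N, Z)` for every
finitely generated `N`. The bottom of `I` could then be cut off, against minimality.

This top degree drops by one under `M ↦ M/yM` (Rees, `extZero_quotSMulTop_iff`) and by `n` under the
`n`-th cosyzygy (`extZero_cosyzygy_iff`), so the two bounds meet. -/

/-- The group `Ext^j_R(N, X)` vanishes. -/
def ExtZero (R : Type u) [CommRing R] (N X : Type u) [AddCommGroup N] [Module R N]
    [AddCommGroup X] [Module R X] (j : ℕ) : Prop :=
  Subsingleton (Abelian.Ext (ModuleCat.of R N) (ModuleCat.of R X) j)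

/-! ### Long exact sequences as closure properties of Ext-vanishing and Ext-finiteness. -/

section ExtVanishing

variable {R : Type u} [CommRing R]

variable {A B C N : Type u} [AddCommGroup A] [Module R A] [AddCommGroup B] [Module R B]
  [AddCommGroup C] [Module R C] [AddCommGroup N] [Module R N]

lemma extZero_iff {j : ℕ} :
    ExtZero R N A j ↔ ∀ x : Abelian.Ext (ModuleCat.of R N) (ModuleCat.of R A) j, x = 0 :=
  ⟨fun h x ↦ h.elim x 0, fun h ↦ ⟨fun x y ↦ (h x).trans (h y).symm⟩⟩

lemma shortExact_of_linearMaps {f : A →ₗ[R] B} {g : B →ₗ[R] C} (hf : Function.Injective f)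
    (hfg : Function.Exact f g) (hg : Function.Surjective g) :
    (ModuleCat.shortComplexOfCompEqZero f g hfg.linearMap_comp_eq_zero).ShortExact :=
  ModuleCat.shortComplex_shortExact _ hfg hf hg

section Covariant

variable {f : A →ₗ[R] B} {g : B →ₗ[R] C}

lemma ExtZero.extension (hf : Function.Injective f) (hfg : Function.Exact f g)
    (hg : Function.Surjective g) {j : ℕ} (hA : ExtZero R N A j) (hC : ExtZero R N C j) :
    ExtZero R N B j := by
  rw [extZero_iff] at *
  intro x
  obtain ⟨y, rfl⟩ := Abelian.Ext.covariant_sequence_exact₂ _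
    (shortExact_of_linearMaps hf hfg hg) x (hC _)
  rw [hA y, Abelian.Ext.zero_comp]

lemma ExtZero.quotient (hf : Function.Injective f) (hfg : Function.Exact f g)
    (hg : Function.Surjective g) {j : ℕ} (hB : ExtZero R N B j) (hA : ExtZero R N A (j + 1)) :
    ExtZero R N C j := by
  rw [extZero_iff] at *
  intro x
  obtain ⟨y, rfl⟩ := Abelian.Ext.covariant_sequence_exact₃ _
    (shortExact_of_linearMaps hf hfg hg) x rfl (hA _)
  rw [hB y, Abelian.Ext.zero_comp]

lemma ExtZero.sub (hf : Function.Injective f) (hfg : Function.Exact f g)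
    (hg : Function.Surjective g) {j : ℕ} (hC : ExtZero R N C j) (hB : ExtZero R N B (j + 1)) :
    ExtZero R N A (j + 1) := by
  rw [extZero_iff] at *
  intro x
  obtain ⟨y, rfl⟩ := Abelian.Ext.covariant_sequence_exact₁ _
    (shortExact_of_linearMaps hf hfg hg) x (hB _) rfl
  rw [hC y, Abelian.Ext.zero_comp]

lemma ExtZero.contra_sub (hf : Function.Injective f) (hfg : Function.Exact f g)
    (hg : Function.Surjective g) {j : ℕ} (hB : ExtZero R B N j) (hC : ExtZero R C N (j + 1)) :
    ExtZero R A N j := by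
  rw [extZero_iff] at *
  intro x
  obtain ⟨y, rfl⟩ := Abelian.Ext.contravariant_sequence_exact₁
    (shortExact_of_linearMaps hf hfg hg) _ x (add_comm _ _) (hC _)
  rw [hB y, Abelian.Ext.comp_zero]

lemma ExtZero.contra_extension (hf : Function.Injective f) (hfg : Function.Exact f g)
    (hg : Function.Surjective g) {j : ℕ} (hA : ExtZero R A N j) (hC : ExtZero R C N j) :
    ExtZero R B N j := by
  rw [extZero_iff] at *
  intro x
  obtain ⟨y, rfl⟩ := Abelian.Ext.contravariant_sequence_exact₂
    (shortExact_of_linearMaps hf hfg hg) _ x (hA _)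
  rw [hC y, Abelian.Ext.comp_zero]

lemma ExtZero.contra_quotient (hf : Function.Injective f) (hfg : Function.Exact f g)
    (hg : Function.Surjective g) {j : ℕ} (hA : ExtZero R A N j) (hB : ExtZero R B N (j + 1)) :
    ExtZero R C N (j + 1) := by
  rw [extZero_iff] at *
  intro x
  obtain ⟨y, rfl⟩ := Abelian.Ext.contravariant_sequence_exact₃
    (shortExact_of_linearMaps hf hfg hg) _ x (hB _) (add_comm 1 j)
  rw [hA y, Abelian.Ext.comp_zero]

lemma ext_finite_extension [IsNoetherianRing R] (hf : Function.Injective f)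
    (hfg : Function.Exact f g) (hg : Function.Surjective g) {j : ℕ}
    (hA : Module.Finite R (Abelian.Ext (ModuleCat.of R N) (ModuleCat.of R A) j))
    (hC : Module.Finite R (Abelian.Ext (ModuleCat.of R N) (ModuleCat.of R C) j)) :
    Module.Finite R (Abelian.Ext (ModuleCat.of R N) (ModuleCat.of R B) j) := by
  let α := (Abelian.Ext.mk₀ (ModuleCat.ofHom f)).postcompOfLinear R (ModuleCat.of R N) (add_zero j)
  let β := (Abelian.Ext.mk₀ (ModuleCat.ofHom g)).postcompOfLinear R (ModuleCat.of R N) (add_zero j)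
  have h : LinearMap.ker β ≤ LinearMap.range α := fun x hx ↦
    Abelian.Ext.covariant_sequence_exact₂ _ (shortExact_of_linearMaps hf hfg hg) x hx
  have h1 : (LinearMap.ker β).FG := by
    have : IsNoetherian R (LinearMap.range α) := inferInstance
    exact (Submodule.fg_top _).1 (Module.Finite.of_injective (Submodule.inclusion h)
      (Submodule.inclusion_injective h)).fg_top
  have h2 : (LinearMap.range β).FG := IsNoetherian.noetherian _
  exact ⟨Submodule.fg_of_fg_map_of_fg_inf_ker β (by rwa [Submodule.map_top]) (by rwa [top_inf_eq])⟩

/-- The connecting map embeds `Ext^j(N, C)` into a Noetherian module. -/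
lemma ext_finite_quotient [IsNoetherianRing R] (hf : Function.Injective f)
    (hfg : Function.Exact f g) (hg : Function.Surjective g) {j : ℕ}
    (hB : ExtZero R N B j)
    (hA : Module.Finite R (Abelian.Ext (ModuleCat.of R N) (ModuleCat.of R A) (j + 1))) :
    Module.Finite R (Abelian.Ext (ModuleCat.of R N) (ModuleCat.of R C) j) := by
  have hS := shortExact_of_linearMaps hf hfg hg
  refine Module.Finite.of_injective
    (hS.extClass.postcompOfLinear R (ModuleCat.of R N) (rfl : j + 1 = j + 1)) ?_
  rw [← LinearMap.ker_eq_bot, LinearMap.ker_eq_bot']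
  intro x hx
  obtain ⟨y, rfl⟩ := Abelian.Ext.covariant_sequence_exact₃ _ hS x rfl hx
  rw [extZero_iff.1 hB y, Abelian.Ext.zero_comp]

end Covariant

lemma extZero_of_injective [Module.Injective R A] (j : ℕ) : ExtZero R N A (j + 1) := by
  have : Injective (ModuleCat.of R A) := Module.injective_object_of_injective_module R A
  exact extZero_iff.2 fun x ↦ x.eq_zero_of_injective

lemma extZero_of_projective [Module.Projective R N] (j : ℕ) : ExtZero R N A (j + 1) := by
  have : Projective (ModuleCat.of R N) := (IsProjective.iff_projective N).1 inferInstance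
  exact extZero_iff.2 fun x ↦ x.eq_zero_of_projective

lemma ExtZero.retract {j : ℕ} (i : A →ₗ[R] B) (p : B →ₗ[R] A) (h : p ∘ₗ i = LinearMap.id)
    (hB : ExtZero R N B j) : ExtZero R N A j := by
  rw [extZero_iff] at *
  intro x
  have h' : ModuleCat.ofHom i ≫ ModuleCat.ofHom p = 𝟙 (ModuleCat.of R A) := by
    rw [← ModuleCat.ofHom_comp, h]; rfl
  rw [← x.comp_mk₀_id, ← h', ← Abelian.Ext.mk₀_comp_mk₀,
    ← Abelian.Ext.comp_assoc (γ := Abelian.Ext.mk₀ (ModuleCat.ofHom p)) x _ (add_zero j) (zero_add 0)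
      (by omega),
    hB (x.comp (Abelian.Ext.mk₀ (ModuleCat.ofHom i)) (add_zero j)), Abelian.Ext.zero_comp]

lemma ExtZero.congr {j : ℕ} (e : A ≃ₗ[R] B) (hB : ExtZero R N B j) : ExtZero R N A j :=
  hB.retract e.toLinearMap e.symm.toLinearMap (by ext; simp)

lemma ExtZero.contra_retract {j : ℕ} (i : A →ₗ[R] B) (p : B →ₗ[R] A) (h : p ∘ₗ i = LinearMap.id)
    (hB : ExtZero R B N j) : ExtZero R A N j := by
  rw [extZero_iff] at *
  intro x
  have h' : ModuleCat.ofHom i ≫ ModuleCat.ofHom p = 𝟙 (ModuleCat.of R A) := by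
    rw [← ModuleCat.ofHom_comp, h]; rfl
  rw [← x.mk₀_id_comp, ← h', ← Abelian.Ext.mk₀_comp_mk₀,
    Abelian.Ext.comp_assoc _ _ _ (zero_add 0) (zero_add j) (by omega),
    hB ((Abelian.Ext.mk₀ (ModuleCat.ofHom p)).comp x (zero_add j)), Abelian.Ext.comp_zero]

lemma ExtZero.contra_congr {j : ℕ} (e : A ≃ₗ[R] B) (hB : ExtZero R B N j) : ExtZero R A N j :=
  hB.contra_retract e.toLinearMap e.symm.toLinearMap (by ext; simp)

lemma extZero_of_subsingleton [Subsingleton A] (j : ℕ) : ExtZero R N A j := by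
  rw [extZero_iff]
  intro x
  have : 𝟙 (ModuleCat.of R A) = 0 := by ext y; exact Subsingleton.elim (α := A) _ _
  rw [← x.comp_mk₀_id, this, Abelian.Ext.mk₀_zero, Abelian.Ext.comp_zero]

lemma extZero_contra_of_subsingleton [Subsingleton A] (j : ℕ) : ExtZero R A N j := by
  rw [extZero_iff]
  intro x
  have : 𝟙 (ModuleCat.of R A) = 0 := by ext y; exact Subsingleton.elim (α := A) _ _
  rw [← x.mk₀_id_comp, this, Abelian.Ext.mk₀_zero, Abelian.Ext.zero_comp]

/-- The exact sequence `0 → A → A^{b + 1} → A^b → 0`. -/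
lemma exact_single_funLeft_succ (b : ℕ) :
    Function.Exact (LinearMap.single R (fun _ : Fin (b + 1) ↦ A) 0)
      (LinearMap.funLeft R A (Fin.succ : Fin b → Fin (b + 1))) := by
  intro x
  constructor
  · intro hx
    refine ⟨x 0, funext fun i ↦ ?_⟩
    refine Fin.cases (by simp) (fun i ↦ ?_) i
    simpa using (congrFun hx i).symm
  · rintro ⟨a, rfl⟩
    ext i
    simp [LinearMap.funLeft_apply]

lemma surjective_funLeft_succ (b : ℕ) :
    Function.Surjective (LinearMap.funLeft R A (Fin.succ : Fin b → Fin (b + 1))) :=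
  LinearMap.funLeft_surjective_of_injective R A _ (Fin.succ_injective b)

lemma injective_single_zero (b : ℕ) :
    Function.Injective (LinearMap.single R (fun _ : Fin (b + 1) ↦ A) 0) :=
  fun x y h ↦ by simpa using congrFun h 0

lemma ExtZero.pi {j : ℕ} (hA : ExtZero R N A j) (b : ℕ) : ExtZero R N (Fin b → A) j := by
  induction b with
  | zero => exact extZero_of_subsingleton j
  | succ b ih =>
    exact hA.extension (injective_single_zero b) (exact_single_funLeft_succ b)
      (surjective_funLeft_succ b) ih

lemma ExtZero.of_pi {j b : ℕ} (hb : b ≠ 0) (hA : ExtZero R N (Fin b → A) j) :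
    ExtZero R N A j := by
  obtain ⟨b, rfl⟩ := Nat.exists_eq_succ_of_ne_zero hb
  exact hA.retract (LinearMap.single R (fun _ ↦ A) 0) (LinearMap.proj 0) (by ext; simp)

lemma extFinite_of_subsingleton [Subsingleton A] : ExtFinite R A := fun N _ _ _ j _ ↦ by
  have := extZero_of_subsingleton (R := R) (A := A) (N := N) j
  rw [ExtZero] at this
  infer_instance

lemma ExtFinite.extension [IsNoetherianRing R] {f : A →ₗ[R] B} {g : B →ₗ[R] C}
    (hf : Function.Injective f) (hfg : Function.Exact f g) (hg : Function.Surjective g)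
    (hA : ExtFinite R A) (hC : ExtFinite R C) : ExtFinite R B := fun N _ _ _ j hj ↦
  ext_finite_extension hf hfg hg (hA N j hj) (hC N j hj)

lemma ExtFinite.quotient [IsNoetherianRing R] {f : A →ₗ[R] B} {g : B →ₗ[R] C}
    (hf : Function.Injective f) (hfg : Function.Exact f g) (hg : Function.Surjective g)
    [Module.Injective R B] (hA : ExtFinite R A) : ExtFinite R C := fun N _ _ _ j hj ↦ by
  obtain ⟨j, rfl⟩ := Nat.exists_eq_add_of_le' hj
  exact ext_finite_quotient hf hfg hg (extZero_of_injective j) (hA N _ (by omega))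

lemma ExtFinite.congr [IsNoetherianRing R] (e : A ≃ₗ[R] B) (hA : ExtFinite R A) :
    ExtFinite R B :=
  hA.extension (f := e.toLinearMap) (g := (0 : B →ₗ[R] PUnit.{u + 1})) e.injective
    ((e.toLinearMap.exact_zero_iff_surjective _).2 e.surjective)
    (Function.surjective_to_subsingleton _) extFinite_of_subsingleton

lemma ExtFinite.pi [IsNoetherianRing R] (hA : ExtFinite R A) (b : ℕ) :
    ExtFinite R (Fin b → A) := by
  induction b with
  | zero => exact extFinite_of_subsingleton
  | succ b ih =>
    exact hA.extension (injective_single_zero b) (exact_single_funLeft_succ b)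
      (surjective_funLeft_succ b) ih

end ExtVanishing

/-! ### `Ext^1`, lifting of maps, and cyclic modules. -/

section ExtOne

variable {R : Type u} [CommRing R]

variable {A B C N : Type u} [AddCommGroup A] [Module R A] [AddCommGroup B] [Module R B]
  [AddCommGroup C] [Module R C] [AddCommGroup N] [Module R N]

/-- If `B` is injective and `0 → A → B → C → 0` is exact, then `Ext^1(N, A) = 0` if and only if
every linear map `N → C` lifts to `B`. -/
lemma extZero_one_iff_lift {f : A →ₗ[R] B} {g : B →ₗ[R] C} (hf : Function.Injective f)
    (hfg : Function.Exact f g) (hg : Function.Surjective g) [Module.Injective R B] :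
    ExtZero R N A 1 ↔ ∀ l : N →ₗ[R] C, ∃ h : N →ₗ[R] B, g ∘ₗ h = l := by
  have hS := shortExact_of_linearMaps hf hfg hg
  rw [extZero_iff]
  constructor
  · intro H l
    obtain ⟨y, hy⟩ := Abelian.Ext.covariant_sequence_exact₃ (ModuleCat.of R N) hS
      (Abelian.Ext.mk₀ (ModuleCat.ofHom l)) (zero_add 1) (H _)
    obtain ⟨h, rfl⟩ := Abelian.Ext.homEquiv₀.symm.surjective y
    refine ⟨h.hom, ?_⟩
    simp only [Abelian.Ext.homEquiv₀_symm_apply, Abelian.Ext.mk₀_comp_mk₀] at hy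
    have := (Abelian.Ext.mk₀_bijective _ _).1 hy
    simpa using congrArg ModuleCat.Hom.hom this
  · intro H x
    obtain ⟨y, rfl⟩ := Abelian.Ext.covariant_sequence_exact₁ (ModuleCat.of R N) hS x
      (extZero_iff.1 (extZero_of_injective 0) _) (zero_add 1)
    obtain ⟨l, rfl⟩ := Abelian.Ext.homEquiv₀.symm.surjective y
    obtain ⟨h, hh⟩ := H l.hom
    have : l = ModuleCat.ofHom h ≫ ModuleCat.ofHom g := by
      rw [← ModuleCat.ofHom_comp, hh]; rfl
    simp only [Abelian.Ext.homEquiv₀_symm_apply]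
    rw [this, ← Abelian.Ext.mk₀_comp_mk₀, Abelian.Ext.comp_assoc _ _ _ (zero_add 0) (zero_add 1)
      (by omega), hS.comp_extClass, Abelian.Ext.comp_zero]

/-- A module `A` is injective if `Ext^1(N, A) = 0` for all finitely generated `N`. -/
lemma injective_of_extZero_one
    (H : ∀ (N : Type u) [AddCommGroup N] [Module R N] [Module.Finite R N], ExtZero R N A 1) :
    Module.Injective R A := by
  refine Module.Baer.injective fun I l ↦ ?_
  have hS := shortExact_of_linearMaps (f := I.subtype) (g := I.mkQ) I.injective_subtype
    (LinearMap.exact_subtype_mkQ I) I.mkQ_surjective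
  -- By Baer's criterion only the cyclic modules `R/I` matter: `Ext^1(R/I, A) = 0` extends maps from
  -- `I` to `R`.
  obtain ⟨y, hy⟩ := Abelian.Ext.contravariant_sequence_exact₁ hS (ModuleCat.of R A)
    (Abelian.Ext.mk₀ (ModuleCat.ofHom l)) (add_zero 1) (extZero_iff.1 (H (R ⧸ I)) _)
  obtain ⟨h, rfl⟩ := Abelian.Ext.homEquiv₀.symm.surjective y
  simp only [Abelian.Ext.homEquiv₀_symm_apply, Abelian.Ext.mk₀_comp_mk₀] at hy
  have := (Abelian.Ext.mk₀_bijective _ _).1 hy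
  exact ⟨h.hom, fun x hx ↦ by
    simpa using LinearMap.congr_fun (congrArg ModuleCat.Hom.hom this) ⟨x, hx⟩⟩

lemma mk₀_smul_comp (x : R) {j : ℕ}
    (e : Abelian.Ext (ModuleCat.of R N) (ModuleCat.of R A) j) :
    (Abelian.Ext.mk₀ (ModuleCat.ofHom (LinearMap.lsmul R N x))).comp e (zero_add j) = x • e := by
  have : ModuleCat.ofHom (LinearMap.lsmul R N x) = x • 𝟙 (ModuleCat.of R N) := by
    ext; rfl
  rw [this, Abelian.Ext.mk₀_smul, Abelian.Ext.smul_comp, Abelian.Ext.mk₀_id_comp]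

/-- The exact sequence `0 → R/I → R/I → R/(I + (x)) → 0` for `x` regular on `R/I`. -/
lemma exact_lsmul_factor (I : Ideal R) (x : R) :
    Function.Exact (LinearMap.lsmul R (R ⧸ I) x)
      (Submodule.factor (le_sup_left : I ≤ I ⊔ Ideal.span {x})) := by
  intro z
  obtain ⟨z, rfl⟩ := Submodule.mkQ_surjective _ z
  have hz' : Submodule.factor (le_sup_left : I ≤ I ⊔ Ideal.span {x}) (I.mkQ z) = 0 ↔
      z ∈ I ⊔ Ideal.span {x} := Submodule.Quotient.mk_eq_zero _
  rw [hz']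
  constructor
  · intro hz
    obtain ⟨a, ha, b, hb, rfl⟩ := Submodule.mem_sup.1 hz
    obtain ⟨c, rfl⟩ := Ideal.mem_span_singleton'.1 hb
    refine ⟨Submodule.Quotient.mk c, ?_⟩
    rw [LinearMap.lsmul_apply, ← Submodule.Quotient.mk_smul, Submodule.mkQ_apply,
      Submodule.Quotient.eq]
    have : x • c - (a + c * x) = - a := by simp [mul_comm]
    rw [this]
    exact I.neg_mem ha
  · rintro ⟨c, hc⟩
    obtain ⟨c, rfl⟩ := Submodule.mkQ_surjective _ c
    rw [LinearMap.lsmul_apply, Submodule.mkQ_apply, ← Submodule.Quotient.mk_smul,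
      Submodule.mkQ_apply, Submodule.Quotient.eq] at hc
    have : z = - (x • c - z) + c * x := by simp [mul_comm]
    rw [this]
    exact Submodule.add_mem_sup (I.neg_mem hc) (Ideal.mul_mem_left _ _ (Ideal.mem_span_singleton_self x))

/-- Dividing by a regular element raises the projective dimension by at most one; this drives the
construction of the test module. -/
lemma ExtZero.quotient_sup_span {I : Ideal R} {x : R} (hx : IsSMulRegular (R ⧸ I) x) {j : ℕ}
    (h : ExtZero R (R ⧸ I) N j) (h' : ExtZero R (R ⧸ I) N (j + 1)) :
    ExtZero R (R ⧸ (I ⊔ Ideal.span {x})) N (j + 1) :=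
  h.contra_quotient (f := LinearMap.lsmul R (R ⧸ I) x) hx (exact_lsmul_factor I x)
    (Submodule.factor_surjective _) h'

end ExtOne

/-! ### Test modules over a Noetherian local ring. -/

section Local

variable {R : Type u} [CommRing R] [IsNoetherianRing R] [IsLocalRing R]
  {Z : Type u} [AddCommGroup Z] [Module R Z]

/-- Vanishing of `Ext^q(-, Z)` on finitely generated modules can be tested on the residue field if
`Z` is Ext-finite and `Ext^{q+1}(-, Z) = 0`. -/
lemma extZero_of_extZero_residue (hZ : ExtFinite R Z) {q : ℕ} (hq : 1 ≤ q)
    (hid : ∀ (N : Type u) [AddCommGroup N] [Module R N], ExtZero R N Z (q + 1))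
    (hk : ExtZero R (R ⧸ IsLocalRing.maximalIdeal R) Z q)
    (N : Type u) [AddCommGroup N] [Module R N] [hN : Module.Finite R N] : ExtZero R N Z q := by
  induction hN using IsNoetherianRing.induction_on_isQuotientEquivQuotientPrime R with
  | subsingleton N => exact extZero_contra_of_subsingleton q
  | exact N₁ N₂ N₃ f g hf hg hfg h₁ h₃ => exact h₁.contra_extension hf hfg hg h₃
  | quotient N p e =>
    refine ExtZero.contra_congr e ?_
    by_cases hp : p.1 = IsLocalRing.maximalIdeal R
    · rw [hp]; exact hk
    have hlt : p.1 < IsLocalRing.maximalIdeal R :=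
      lt_of_le_of_ne (IsLocalRing.le_maximalIdeal p.2.ne_top) hp
    obtain ⟨x, hxm, hxp⟩ := SetLike.exists_of_lt hlt
    have hx : IsSMulRegular (R ⧸ p.1) x := by
      have := p.2
      refine isSMulRegular_iff_right_eq_zero_of_smul.2 fun z hz ↦ ?_
      obtain ⟨z, rfl⟩ := Submodule.mkQ_surjective _ z
      rw [Submodule.mkQ_apply, ← Submodule.Quotient.mk_smul, Submodule.Quotient.mk_eq_zero,
        smul_eq_mul] at hz
      rw [Submodule.mkQ_apply, Submodule.Quotient.mk_eq_zero]
      exact (this.mem_or_mem hz).resolve_left hxp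
    have hfin := hZ (R ⧸ p.1) q hq
    have hS := shortExact_of_linearMaps (f := LinearMap.lsmul R (R ⧸ p.1) x) hx
      (exact_lsmul_factor p.1 x) (Submodule.factor_surjective _)
    -- Since `Ext^{q+1}(-, Z)` vanishes, `x` acts surjectively on `Ext^q(R/p, Z)`. As `x` lies in
    -- the maximal ideal and this module is finitely generated, Nakayama makes it zero.
    have key : (⊤ : Submodule R (Abelian.Ext (ModuleCat.of R (R ⧸ p.1)) (ModuleCat.of R Z) q)) ≤
        Ideal.span {x} • ⊤ := by
      intro e _
      obtain ⟨e', rfl⟩ := Abelian.Ext.contravariant_sequence_exact₁ hS _ e (add_comm 1 q)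
        (extZero_iff.1 (hid _) _)
      have := mk₀_smul_comp x e'
      dsimp at this ⊢
      rw [this]
      exact Submodule.smul_mem_smul (Ideal.mem_span_singleton_self x) trivial
    have := Submodule.eq_bot_of_le_smul_of_le_jacobson_bot _ _ hfin.fg_top key (by
      rw [IsLocalRing.jacobson_eq_maximalIdeal ⊥ bot_ne_top, Ideal.span_singleton_le_iff_mem]
      exact hxm)
    exact (Submodule.subsingleton_iff R).1 (subsingleton_of_bot_eq_top this.symm)

variable (R) in
/-- If `y` in the maximal ideal is regular or zero, there is a proper ideal `J` containing
`y` such that `R/J` has finite projective dimension and the residue field embeds in `R/J`. -/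
lemma exists_ideal_extZero_residue {y : R} (hym : y ∈ IsLocalRing.maximalIdeal R)
    (hy : y = 0 ∨ IsSMulRegular R y) :
    ∃ J : Ideal R, y ∈ J ∧
      (∃ n, ∀ j, n ≤ j → ∀ (X : Type u) [AddCommGroup X] [Module R X], ExtZero R (R ⧸ J) X j) ∧
      ∃ f : (R ⧸ IsLocalRing.maximalIdeal R) →ₗ[R] R ⧸ J, Function.Injective f := by
  -- Finite projective dimension of `R/J` is encoded as vanishing of Ext in all large degrees. The
  -- desired ideal is a maximal element of `P`.
  let P : Set (Ideal R) := {J | y ∈ J ∧ J ≠ ⊤ ∧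
    ∃ n, ∀ j, n ≤ j → ∀ (X : Type u) [AddCommGroup X] [Module R X], ExtZero R (R ⧸ J) X j}
  have step : ∀ (J : Ideal R) (x : R), IsSMulRegular (R ⧸ J) x →
      (∃ n, ∀ j, n ≤ j → ∀ (X : Type u) [AddCommGroup X] [Module R X], ExtZero R (R ⧸ J) X j) →
      ∃ n, ∀ j, n ≤ j → ∀ (X : Type u) [AddCommGroup X] [Module R X],
        ExtZero R (R ⧸ (J ⊔ Ideal.span {x})) X j := by
    rintro J x hx ⟨n, hn⟩
    refine ⟨n + 1, fun j hj X _ _ ↦ ?_⟩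
    obtain ⟨j, rfl⟩ := Nat.exists_eq_add_of_le' (show 1 ≤ j by omega)
    exact ExtZero.quotient_sup_span hx (hn j (by omega) X) (hn (j + 1) (by omega) X)
  have h0 : ∃ n, ∀ j, n ≤ j → ∀ (X : Type u) [AddCommGroup X] [Module R X],
      ExtZero R (R ⧸ (⊥ : Ideal R)) X j := by
    refine ⟨1, fun j hj X _ _ ↦ ?_⟩
    obtain ⟨j, rfl⟩ := Nat.exists_eq_add_of_le' hj
    exact ExtZero.contra_congr (Submodule.quotEquivOfEqBot ⊥ rfl) (extZero_of_projective j)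
  have hne : P.Nonempty := by
    rcases hy with rfl | hy
    · exact ⟨⊥, zero_mem _, bot_ne_top, h0⟩
    · have hle : ⊥ ⊔ Ideal.span {y} ≤ IsLocalRing.maximalIdeal R := by
        simpa [Ideal.span_singleton_le_iff_mem] using hym
      refine ⟨⊥ ⊔ Ideal.span {y}, Submodule.mem_sup_right (Ideal.mem_span_singleton_self y),
        fun h ↦ ?_, step ⊥ y ?_ h0⟩
      · rw [h] at hle
        exact Ideal.IsPrime.ne_top' (top_le_iff.1 hle)
      · exact (LinearEquiv.isSMulRegular_congr (Submodule.quotEquivOfEqBot ⊥ rfl) y).2 hy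
  obtain ⟨J, ⟨hyJ, hJ, hn⟩, hmax⟩ := set_has_maximal_iff_noetherian.2 ‹_› P hne
  refine ⟨J, hyJ, hn, ?_⟩
  have hJm := IsLocalRing.le_maximalIdeal hJ
  have : Nontrivial (R ⧸ J) := Submodule.Quotient.nontrivial_iff.2 hJ
  -- An `R/J`-regular `x` in the maximal ideal would put the strictly larger ideal `J + (x)` into
  -- `P`.
  have hzd : (IsLocalRing.maximalIdeal R : Set R) ⊆ ⋃ p ∈ associatedPrimes R (R ⧸ J), p := by
    rw [biUnion_associatedPrimes_eq_compl_regular]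
    intro x hx hreg
    refine hmax (J ⊔ Ideal.span {x}) ⟨Submodule.mem_sup_left hyJ, fun h ↦ ?_, step J x hreg hn⟩
      (lt_of_le_of_ne le_sup_left fun h ↦ ?_)
    · have : J ⊔ Ideal.span {x} ≤ IsLocalRing.maximalIdeal R :=
        sup_le hJm ((Ideal.span_singleton_le_iff_mem _).2 hx)
      rw [h] at this
      exact Ideal.IsPrime.ne_top' (top_le_iff.1 this)
    · have hxJ : x ∈ J := by
        rw [h]; exact Submodule.mem_sup_right (Ideal.mem_span_singleton_self x)
      obtain ⟨z, hz⟩ := exists_ne (0 : R ⧸ J)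
      refine hz (hreg ?_)
      obtain ⟨z, rfl⟩ := Submodule.mkQ_surjective _ z
      simp only [Submodule.mkQ_apply, smul_zero]
      rw [← Submodule.Quotient.mk_smul, Submodule.Quotient.mk_eq_zero, smul_eq_mul]
      exact Ideal.mul_mem_right _ J hxJ
  -- Prime avoidance: the maximal ideal is itself associated to `R/J`.
  obtain ⟨p, hp, hle⟩ := (Ideal.subset_union_prime_finite (associatedPrimes.finite R (R ⧸ J))
    (f := id) 0 0 fun _ h _ _ ↦ h.1).1 hzd
  have hpm : p = IsLocalRing.maximalIdeal R :=
    ((IsLocalRing.maximalIdeal.isMaximal R).eq_of_le hp.1.ne_top hle).symm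
  subst hpm
  exact ((isAssociatedPrime_iff_exists_injective_linearMap _ _).1 hp).2

end Local

/-! ### Homology via cycles and boundaries, and the quasi-injective dimension as a minimal natural
number. -/

section Complexes

variable {R : Type u} [CommRing R]

namespace ChainComplex

variable (I : ChainComplex (ModuleCat.{u} R) ℤ)

/-- The submodule of cycles in degree `i`. -/
def cyc (i : ℤ) : Submodule R (I.X i) := LinearMap.ker (I.d i (i - 1)).hom

/-- The submodule of boundaries in degree `i`. -/
def bdry (i : ℤ) : Submodule R (I.X i) := LinearMap.range (I.d (i + 1) i).hom

variable {I}

lemma mem_cyc {i : ℤ} (j : ℤ) (h : j + 1 = i) {x : I.X i} : x ∈ cyc I i ↔ I.d i j x = 0 := by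
  obtain rfl : j = i - 1 := by omega
  rfl

lemma d_d_apply (i j k : ℤ) (x : I.X i) : I.d j k (I.d i j x) = 0 := by
  rw [← ModuleCat.comp_apply, I.d_comp_d]; rfl

variable (I) in
lemma bdry_le_cyc (i : ℤ) : bdry I i ≤ cyc I i := by
  rintro _ ⟨w, rfl⟩
  exact (mem_cyc (i - 1) (by omega)).2 (d_d_apply _ _ _ _)

/-- The isomorphism of the homology with cycles modulo boundaries. -/
lemma nonempty_homology_equiv_quotient (i : ℤ) :
    Nonempty (I.homology i ≃ₗ[R] (cyc I i ⧸ (bdry I i).comap (cyc I i).subtype)) := by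
  have h1 : (ComplexShape.down ℤ).prev i = i + 1 := (ComplexShape.down ℤ).prev_eq' rfl
  have h2 : (ComplexShape.down ℤ).next i = i - 1 :=
    (ComplexShape.down ℤ).next_eq' (by simp)
  let S := I.sc' (i + 1) i (i - 1)
  let e₁ : I.homology i ≅ S.homology :=
    ShortComplex.homologyMapIso (I.isoSc' (i + 1) i (i - 1) h1 h2)
  let e₂ := S.moduleCatHomologyIso
  have hr : LinearMap.range S.moduleCatToCycles = (bdry I i).comap (cyc I i).subtype := by
    ext z
    constructor
    · rintro ⟨w, rfl⟩
      exact ⟨w, rfl⟩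
    · rintro ⟨w, hw⟩
      exact ⟨w, Subtype.ext hw⟩
  exact ⟨(e₁ ≪≫ e₂).toLinearEquiv.trans (Submodule.quotEquivOfEq _ _ hr)⟩

lemma nonempty_homology_equiv_iff (i : ℤ) {H : Type*} [AddCommGroup H] [Module R H] :
    Nonempty (I.homology i ≃ₗ[R] H) ↔ ∃ f : cyc I i →ₗ[R] H, Function.Surjective f ∧
      ∀ z, f z = 0 ↔ (z : I.X i) ∈ bdry I i := by
  obtain ⟨e⟩ := nonempty_homology_equiv_quotient (I := I) i
  constructor
  · rintro ⟨e'⟩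
    refine ⟨(e.symm.trans e').toLinearMap ∘ₗ Submodule.mkQ _,
      (e.symm.trans e').surjective.comp (Submodule.mkQ_surjective _), fun z ↦ ?_⟩
    rw [LinearMap.comp_apply, LinearEquiv.coe_coe, LinearEquiv.map_eq_zero_iff,
      Submodule.mkQ_apply, Submodule.Quotient.mk_eq_zero]
    rfl
  · rintro ⟨f, hf, hk⟩
    have : (bdry I i).comap (cyc I i).subtype = LinearMap.ker f := by
      ext z; exact (hk z).symm
    exact ⟨e.trans ((Submodule.quotEquivOfEq _ _ this).trans (f.quotKerEquivOfSurjective hf))⟩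

end ChainComplex

open ChainComplex

/-- A bounded quasi-injective resolution of `M` with multiplicities `b` which vanishes in degrees
below `a` and whose lowest homology sits in degree `a + k`. -/
structure IsQIR (M : Type u) [AddCommGroup M] [Module R M] (I : ChainComplex (ModuleCat.{u} R) ℤ)
    (b : ℤ → ℕ) (a : ℤ) (k : ℕ) : Prop where
  above : ∃ c : ℤ, ∀ i, c < i → Subsingleton (I.X i)
  below : ∀ i < a, Subsingleton (I.X i)
  inj : ∀ i, Module.Injective R (I.X i)
  hom : ∀ i, ∃ f : cyc I i →ₗ[R] (Fin (b i) → M), Function.Surjective f ∧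
    ∀ z, f z = 0 ↔ (z : I.X i) ∈ bdry I i
  b_zero : ∀ i < a + k, b i = 0
  b_ne : b (a + k) ≠ 0

variable (R) in
/-- There is a bounded quasi-injective resolution of `M` with `hinf I - inf I ≤ k`. -/
def HasQIR (M : Type u) [AddCommGroup M] [Module R M] (k : ℕ) : Prop :=
  ∃ (I : ChainComplex (ModuleCat.{u} R) ℤ) (b : ℤ → ℕ) (a : ℤ), IsQIR M I b a k

variable {M : Type u} [AddCommGroup M] [Module R M]

lemma isZero_iff_of_equiv_pi [Nontrivial M] {X : ModuleCat.{u} R} {b : ℕ}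
    (e : X ≃ₗ[R] (Fin b → M)) : Limits.IsZero X ↔ b = 0 := by
  rw [ModuleCat.isZero_iff_subsingleton, e.toEquiv.subsingleton_congr]
  constructor
  · intro h
    by_contra hb
    have : Nonempty (Fin b) := ⟨⟨0, by omega⟩⟩
    exact not_subsingleton (Fin b → M) h
  · rintro rfl
    infer_instance

lemma IsQIR.isBounded {I : ChainComplex (ModuleCat.{u} R) ℤ} {b : ℤ → ℕ} {a : ℤ} {k : ℕ}
    (h : IsQIR M I b a k) : IsBoundedQuasiInjectiveResolution R M I where
  boundedAbove := by
    obtain ⟨c, hc⟩ := h.above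
    exact ⟨c, fun i hi ↦ ModuleCat.isZero_iff_subsingleton.2 (hc i hi)⟩
  injective i := by
    have := h.inj i
    exact Module.injective_object_of_injective_module R (I.X i)
  homology_equiv := ⟨b, ⟨_, h.b_ne⟩, fun i ↦ (nonempty_homology_equiv_iff i).2 (h.hom i)⟩
  boundedBelow := ⟨a, fun i hi ↦ ModuleCat.isZero_iff_subsingleton.2 (h.below i hi)⟩

lemma exists_isQIR [Nontrivial M] {I : ChainComplex (ModuleCat.{u} R) ℤ} {h a : ℤ}
    (hI : IsBoundedQuasiInjectiveResolution R M I)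
    (hh : IsLeast {i : ℤ | ¬ Limits.IsZero (I.homology i)} h)
    (ha : IsLeast {i : ℤ | ¬ Limits.IsZero (I.X i)} a) :
    ∃ (b : ℤ → ℕ) (k : ℕ), h = a + k ∧ IsQIR M I b a k := by
  obtain ⟨b, -, hb⟩ := hI.homology_equiv
  have hle : a ≤ h := by
    refine ha.2 fun h0 ↦ hh.1 ?_
    rw [ModuleCat.isZero_iff_subsingleton] at h0 ⊢
    obtain ⟨e⟩ := nonempty_homology_equiv_quotient (I := I) h
    rw [e.toEquiv.subsingleton_congr]
    infer_instance
  obtain ⟨k, hk⟩ := Int.eq_ofNat_of_zero_le (sub_nonneg.2 hle)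
  obtain rfl : h = a + k := by omega
  refine ⟨b, k, rfl, ?_, fun i hi ↦ ?_, fun i ↦ ?_, fun i ↦ ?_, fun i hi ↦ ?_, ?_⟩
  · obtain ⟨c, hc⟩ := hI.boundedAbove
    exact ⟨c, fun i hi ↦ ModuleCat.isZero_iff_subsingleton.1 (hc i hi)⟩
  · rw [← ModuleCat.isZero_iff_subsingleton]
    by_contra h0
    exact absurd (ha.2 h0) (by omega)
  · have := hI.injective i
    exact Module.injective_module_of_injective_object R (I.X i)
  · exact (nonempty_homology_equiv_iff i).1 (hb i)
  · by_contra h0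
    obtain ⟨e⟩ := hb i
    exact absurd (hh.2 (fun hz ↦ h0 ((isZero_iff_of_equiv_pi e).1 hz))) (by omega)
  · obtain ⟨e⟩ := hb (a + k)
    exact fun h0 ↦ hh.1 ((isZero_iff_of_equiv_pi e).2 h0)

lemma le_qid [Nontrivial M] {s : ℕ} (h : ∀ k, HasQIR R M k → s ≤ k) : (s : EReal) ≤ qid R M := by
  rw [qid, if_neg (not_subsingleton M)]
  refine le_sInf ?_
  rintro d ⟨I, h', a, hI, hh, ha, rfl⟩
  obtain ⟨b, k, rfl, hk⟩ := exists_isQIR hI hh ha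
  have := h k ⟨I, b, a, hk⟩
  rw [add_sub_cancel_left, Int.cast_natCast, EReal.coe_natCast]
  exact_mod_cast this

lemma HasQIR.qid_le [Nontrivial M] {k : ℕ} (h : HasQIR R M k) : qid R M ≤ (k : EReal) := by
  obtain ⟨I, b, a, hI⟩ := h
  have hhom (i : ℤ) := (nonempty_homology_equiv_iff (I := I) i).2 (hI.hom i)
  have hh : IsLeast {i : ℤ | ¬ Limits.IsZero (I.homology i)} (a + k) := by
    constructor
    · obtain ⟨e⟩ := hhom (a + k)
      exact fun hz ↦ hI.b_ne ((isZero_iff_of_equiv_pi e).1 hz)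
    · intro i hi
      by_contra! hlt
      obtain ⟨e⟩ := hhom i
      exact hi ((isZero_iff_of_equiv_pi e).2 (hI.b_zero i hlt))
  have hlow : ∀ i, ¬ Limits.IsZero (I.X i) → a ≤ i := fun i hi ↦ by
    by_contra! hlt
    exact hi (ModuleCat.isZero_iff_subsingleton.2 (hI.below i hlt))
  have hne : ∃ i, ¬ Limits.IsZero (I.X i) := by
    by_contra! h0
    refine hh.1 ?_
    have := h0 (a + k)
    rw [ModuleCat.isZero_iff_subsingleton] at this ⊢
    obtain ⟨e⟩ := nonempty_homology_equiv_quotient (I := I) (a + k)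
    rw [e.toEquiv.subsingleton_congr]
    infer_instance
  -- `a` only bounds the support from below; the lowest nonzero degree `a' ≥ a` can only shorten the
  -- distance to `a + k`.
  obtain ⟨a', ha', hmin⟩ := Int.exists_least_of_bdd ⟨a, hlow⟩ hne
  rw [qid, if_neg (not_subsingleton M)]
  refine sInf_le_of_le (b := (((a + k - a' : ℤ) : ℝ) : EReal))
    ⟨I, a + k, a', hI.isBounded, hh, ⟨ha', hmin⟩, rfl⟩ ?_
  have : a + k - a' ≤ k := by have := hlow a' ha'; omega
  have : ((a + k - a' : ℤ) : ℝ) ≤ (k : ℝ) := by exact_mod_cast this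
  exact_mod_cast this

lemma exists_hasQIR_of_qid_lt_top [Nontrivial M] (h : qid R M < ⊤) :
    ∃ k : ℕ, qid R M = (k : EReal) ∧ HasQIR R M k ∧ ∀ k', HasQIR R M k' → k ≤ k' := by
  have hne : ∃ k, HasQIR R M k := by
    by_contra! h0
    have := h
    rw [qid, if_neg (not_subsingleton M), sInf_lt_iff] at this
    obtain ⟨d, ⟨I, h', a, hI, hh, ha, rfl⟩, -⟩ := this
    obtain ⟨b, k, -, hk⟩ := exists_isQIR hI hh ha
    exact h0 k ⟨I, b, a, hk⟩
  classical
  refine ⟨Nat.find hne, le_antisymm (Nat.find_spec hne).qid_le (le_qid fun k hk ↦ Nat.find_min' hne hk),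
    Nat.find_spec hne, fun k hk ↦ Nat.find_min' hne hk⟩

/-! ### Dimension shifting along cycles and boundaries. -/

section Cycles

variable {I : ChainComplex (ModuleCat.{u} R) ℤ} {b : ℤ → ℕ} {a : ℤ} {k : ℕ}

/-- The differential as a map onto the boundaries. -/
noncomputable def toBdry (I : ChainComplex (ModuleCat.{u} R) ℤ) (i : ℤ) :
    I.X (i + 1) →ₗ[R] bdry I i :=
  (I.d (i + 1) i).hom.rangeRestrict

lemma toBdry_surjective (i : ℤ) : Function.Surjective (toBdry I i) :=
  LinearMap.surjective_rangeRestrict _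

lemma exact_cyc_toBdry (i : ℤ) : Function.Exact (cyc I (i + 1)).subtype (toBdry I i) := by
  intro x
  have : x ∈ Set.range (cyc I (i + 1)).subtype ↔ x ∈ cyc I (i + 1) := by simp
  rw [this, mem_cyc i rfl]
  exact Subtype.ext_iff

lemma exact_bdry_cyc {i : ℤ} {H : Type*} [AddCommGroup H] [Module R H] {f : cyc I i →ₗ[R] H}
    (hf : ∀ z, f z = 0 ↔ (z : I.X i) ∈ bdry I i) :
    Function.Exact (Submodule.inclusion (bdry_le_cyc I i)) f := by
  intro z
  rw [hf]
  exact ⟨fun h ↦ ⟨⟨z, h⟩, rfl⟩, by rintro ⟨w, rfl⟩; exact w.2⟩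

lemma IsQIR.bdry_eq_cyc (h : IsQIR M I b a k) {i : ℤ} (hi : i < a + k) :
    bdry I i = cyc I i := by
  refine le_antisymm (bdry_le_cyc I i) fun z hz ↦ ?_
  obtain ⟨f, -, hf⟩ := h.hom i
  refine (hf ⟨z, hz⟩).1 ?_
  have : Subsingleton (Fin (b i) → M) := by rw [h.b_zero i hi]; infer_instance
  exact Subsingleton.elim _ _

lemma IsQIR.cyc_eq_top (h : IsQIR M I b a k) : cyc I a = ⊤ := by
  refine top_le_iff.1 fun z _ ↦ ?_
  have := h.below (a - 1) (by omega)
  exact (mem_cyc (a - 1) (by omega)).2 (Subsingleton.elim _ _)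

/-- The cycles in the degree of the lowest homology have injective dimension at most `k`. -/
lemma IsQIR.extZero_cyc (h : IsQIR M I b a k) {l : ℕ} (hl : l ≤ k) {i : ℤ} (hi : i = a + l)
    {N : Type u} [AddCommGroup N] [Module R N] {j : ℕ} (hj : l < j) :
    ExtZero R N (cyc I i) j := by
  obtain ⟨j, rfl⟩ := Nat.exists_eq_add_of_le' (show 1 ≤ j by omega)
  induction l generalizing i j with
  | zero =>
    obtain rfl : i = a := by simpa using hi
    have := h.inj i
    rw [h.cyc_eq_top]
    exact (extZero_of_injective j).congr Submodule.topEquiv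
  | succ l ih =>
    obtain ⟨j, rfl⟩ := Nat.exists_eq_add_of_le' (show 1 ≤ j by omega)
    obtain ⟨i, rfl⟩ : ∃ i', i = i' + 1 := ⟨i - 1, by omega⟩
    have := h.inj (i + 1)
    -- Below degree `a + k` the complex is exact, so `0 → Z_{i+1} → I_{i+1} → Z_i → 0` raises the
    -- injective dimension by at most one, starting from `Z_a = I_a`.
    refine ExtZero.sub (Submodule.injective_subtype _) (exact_cyc_toBdry i) (toBdry_surjective i) ?_
      (extZero_of_injective _)
    rw [h.bdry_eq_cyc (by push_cast at hi; omega)]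
    exact ih (by omega) (by push_cast at hi; omega) j (by omega)

/-- The converse shift along `0 → Z_{i+1} → I_{i+1} → Z_i → 0`, with `l` counting steps down from
degree `a + k`. For `l = k - 1` it reaches `Ext^1(N, Z_{a+1}) = 0`. -/
lemma IsQIR.extZero_cyc_of_le (h : IsQIR M I b a k) {N : Type u} [AddCommGroup N] [Module R N]
    {l : ℕ} (hl : l + 1 ≤ k) (hN : ExtZero R N (cyc I (a + k)) k) {i : ℤ}
    (hi : i = a + (k - l : ℕ)) : ExtZero R N (cyc I i) (k - l) := by
  induction l generalizing i with
  | zero =>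
    obtain rfl : i = a + k := by simpa using hi
    exact hN
  | succ l ih =>
    have := h.inj (i + 1)
    rw [← h.bdry_eq_cyc (by omega)]
    have h1 : k - (l + 1) = k - (l + 2) + 1 := by omega
    rw [h1]
    refine ExtZero.quotient (Submodule.injective_subtype _) (exact_cyc_toBdry i)
      (toBdry_surjective i) (extZero_of_injective _) ?_
    rw [← h1, show k - (l + 1) + 1 = k - l by omega]
    exact ih (by omega) (by omega)

/-- A property of modules that holds for `M`, and passes to extensions and to quotients of the
modules `I_i`, holds for all cycles and boundaries. -/
lemma IsQIR.induction (h : IsQIR M I b a k)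
    (P : ∀ (X : Type u) [AddCommGroup X] [Module R X], Prop)
    (P0 : ∀ (X : Type u) [AddCommGroup X] [Module R X], Subsingleton X → P X)
    (Pext : ∀ (A B C : Type u) [AddCommGroup A] [Module R A] [AddCommGroup B] [Module R B]
      [AddCommGroup C] [Module R C] (f : A →ₗ[R] B) (g : B →ₗ[R] C), Function.Injective f →
      Function.Exact f g → Function.Surjective g → P A → P C → P B)
    (Pquot : ∀ (A B C : Type u) [AddCommGroup A] [Module R A] [AddCommGroup B] [Module R B]
      [AddCommGroup C] [Module R C] (f : A →ₗ[R] B) (g : B →ₗ[R] C), Function.Injective f →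
      Function.Exact f g → Function.Surjective g → Module.Injective R B → P A → P C)
    (PM : ∀ b : ℕ, P (Fin b → M)) (i : ℤ) : P (cyc I i) ∧ P (bdry I i) := by
  obtain ⟨c, hc⟩ := h.above
  -- Descend from the degrees above `c`, where all is zero: `B_i` is `I_{i+1}/Z_{i+1}`, and `Z_i` is
  -- an extension of a power of `M` by `B_i`.
  have key : ∀ n : ℕ, ∀ i : ℤ, c < i + n → P (cyc I i) ∧ P (bdry I i) := by
    intro n
    induction n with
    | zero =>
      intro i hi
      have := hc i (by simpa using hi)
      exact ⟨P0 _ inferInstance, P0 _ inferInstance⟩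
    | succ n ih =>
      intro i hi
      have hB : P (bdry I i) := Pquot _ _ _ _ _ (Submodule.injective_subtype _)
        (exact_cyc_toBdry i) (toBdry_surjective i) (h.inj _)
        (ih (i + 1) (by push_cast at hi; omega)).1
      obtain ⟨f, hf, hk⟩ := h.hom i
      exact ⟨Pext _ _ _ _ _ (Submodule.inclusion_injective _) (exact_bdry_cyc hk) hf hB (PM _), hB⟩
  refine key (c - i + 1).toNat i ?_
  have := Int.self_le_toNat (c - i + 1)
  omega

lemma IsQIR.extZero_of_le (h : IsQIR M I b a k) {F : Type u} [AddCommGroup F] [Module R F] {s : ℕ}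
    (hs : 1 ≤ s) (hF : ∀ j, s ≤ j → ExtZero R F M j) (i : ℤ) :
    (∀ j, s ≤ j → ExtZero R F (cyc I i) j) ∧ (∀ j, s ≤ j → ExtZero R F (bdry I i) j) := by
  refine h.induction (fun X _ _ ↦ ∀ j, s ≤ j → ExtZero R F X j) ?_ ?_ ?_ ?_ i
  · intro X _ _ _ j _
    exact extZero_of_subsingleton j
  · intro A B C _ _ _ _ _ _ f g hf hfg hg hA hC j hj
    exact (hA j hj).extension hf hfg hg (hC j hj)
  · intro A B C _ _ _ _ _ _ f g hf hfg hg _ hA j hj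
    obtain ⟨j, rfl⟩ := Nat.exists_eq_add_of_le' (hs.trans hj)
    exact ExtZero.quotient hf hfg hg (extZero_of_injective j) (hA _ (by omega))
  · intro b j hj
    exact (hF j hj).pi b

lemma IsQIR.extFinite_cyc [IsNoetherianRing R] (h : IsQIR M I b a k) (hM : ExtFinite R M) (i : ℤ) :
    ExtFinite R (cyc I i) := by
  refine (h.induction (fun X _ _ ↦ ExtFinite R X) ?_ ?_ ?_ ?_ i).1
  · intro X _ _ _
    exact extFinite_of_subsingleton
  · intro A B C _ _ _ _ _ _ f g hf hfg hg hA hC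
    exact hA.extension hf hfg hg hC
  · intro A B C _ _ _ _ _ _ f g hf hfg hg _ hA
    exact hA.quotient hf hfg hg
  · intro b
    exact hM.pi b

/-- The top degree in which `Ext(F, M)` does not vanish is a lower bound for the
quasi-injective dimension. -/
lemma HasQIR.le_of_not_extZero (h : HasQIR R M k) {F : Type u} [AddCommGroup F] [Module R F]
    {s : ℕ} (hF : ∀ j, s < j → ExtZero R F M j) (hs : ¬ ExtZero R F M s) : s ≤ k := by
  by_contra! hlt
  obtain ⟨I, b, a, hI⟩ := h
  obtain ⟨f, hf, hk⟩ := hI.hom (a + k)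
  refine hs (ExtZero.of_pi hI.b_ne ?_)
  -- In `0 → B → Z → M^b → 0` at degree `a + k`, `Ext^s(F, Z) = 0` because `s > k`, and
  -- `Ext^{s+1}(F, B) = 0` because `Ext(F, M)` vanishes above `s`.
  exact ExtZero.quotient (Submodule.inclusion_injective _) (exact_bdry_cyc hk) hf
    (hI.extZero_cyc le_rfl rfl hlt)
    ((hI.extZero_of_le (by omega) (fun j hj ↦ hF j hj) (a + k)).2 (s + 1) le_rfl)

end Cycles

end Complexes

open ChainComplex

/-! ### Cutting off the bottom, and detection of the minimal length by Ext. -/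

section Truncation

variable {R : Type u} [CommRing R] {M : Type u} [AddCommGroup M] [Module R M]

/-- The subcomplex given by a family of submodules stable under the differential. -/
noncomputable def ChainComplex.subcomplex (I : ChainComplex (ModuleCat.{u} R) ℤ)
    (S : ∀ i, Submodule R (I.X i)) (hS : ∀ i j, ∀ x ∈ S i, I.d i j x ∈ S j) :
    ChainComplex (ModuleCat.{u} R) ℤ where
  X i := ModuleCat.of R (S i)
  d i j := ModuleCat.ofHom ((I.d i j).hom.restrict (hS i j))
  shape i j hij := by
    ext x
    change I.d i j x.1 = 0
    rw [I.shape i j hij]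
    rfl
  d_comp_d' i j k _ _ := by
    ext x
    exact d_d_apply i j k x.1

variable {I : ChainComplex (ModuleCat.{u} R) ℤ} {b : ℤ → ℕ} {a : ℤ} {k : ℕ}

lemma ChainComplex.mem_cyc_subcomplex {S : ∀ i, Submodule R (I.X i)}
    {hS : ∀ i j, ∀ x ∈ S i, I.d i j x ∈ S j} {i : ℤ} (x : S i) :
    (show (subcomplex I S hS).X i from x) ∈ cyc (subcomplex I S hS) i ↔ (x : I.X i) ∈ cyc I i :=
  Subtype.ext_iff

/-- The inclusion of a subcomplex. -/
noncomputable def ChainComplex.subcomplexInclusion {S : ∀ i, Submodule R (I.X i)}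
    {hS : ∀ i j, ∀ x ∈ S i, I.d i j x ∈ S j} (i : ℤ) : (subcomplex I S hS).X i →ₗ[R] I.X i :=
  (S i).subtype

open Classical in
/-- The family of submodules defining the truncation above degree `c`. -/
noncomputable def truncFamily (I : ChainComplex (ModuleCat.{u} R) ℤ) (c i : ℤ) :
    Submodule R (I.X i) :=
  if c < i then ⊤ else if i = c then cyc I i else ⊥

lemma truncFamily_of_lt {c i : ℤ} (h : c < i) : truncFamily I c i = ⊤ := if_pos h

lemma truncFamily_self (c : ℤ) : truncFamily I c c = cyc I c := by
  simp [truncFamily]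

lemma truncFamily_of_gt {c i : ℤ} (h : i < c) : truncFamily I c i = ⊥ := by
  rw [truncFamily, if_neg (by omega), if_neg (by omega)]

lemma cyc_le_truncFamily {c i : ℤ} (h : c ≤ i) : cyc I i ≤ truncFamily I c i := by
  rcases h.lt_or_eq with h | rfl
  · rw [truncFamily_of_lt h]; exact le_top
  · rw [truncFamily_self]

lemma d_mem_truncFamily (c i j : ℤ) (x : I.X i) (hx : x ∈ truncFamily I c i) :
    I.d i j x ∈ truncFamily I c j := by
  by_cases hij : j + 1 = i
  · rcases lt_trichotomy i c with h | h | h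
    · rw [truncFamily_of_gt h, Submodule.mem_bot] at hx
      rw [hx, map_zero]
      exact zero_mem _
    · subst h
      rw [truncFamily_self, mem_cyc j hij] at hx
      rw [hx]
      exact zero_mem _
    · refine cyc_le_truncFamily (by omega) ?_
      exact (mem_cyc (j - 1) (by omega)).2 (d_d_apply _ _ _ _)
  · rw [I.shape i j hij]
    exact zero_mem _

/-- A quasi-injective resolution can be shortened if the lowest differential has an injective
kernel. -/
lemma IsQIR.truncate (h : IsQIR M I b a (k + 1)) (hinj : Module.Injective R (cyc I (a + 1))) :
    IsQIR M (subcomplex I (truncFamily I (a + 1)) (d_mem_truncFamily (a + 1))) b (a + 1) k where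
  above := by
    obtain ⟨c, hc⟩ := h.above
    refine ⟨c, fun i hi ↦ ?_⟩
    have := hc i hi
    change Subsingleton (truncFamily I (a + 1) i)
    infer_instance
  below i hi := by
    change Subsingleton (truncFamily I (a + 1) i)
    rw [truncFamily_of_gt hi]
    infer_instance
  inj i := by
    change Module.Injective R (truncFamily I (a + 1) i)
    rcases lt_trichotomy i (a + 1) with hi | rfl | hi
    · rw [truncFamily_of_gt hi]
      exact ⟨fun _ _ _ _ _ _ _ _ _ ↦ ⟨0, fun _ ↦ Subsingleton.elim _ _⟩⟩
    · rwa [truncFamily_self]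
    · rw [truncFamily_of_lt hi]
      have := h.inj i
      exact Module.Baer.injective ((Module.Baer.of_injective this).of_equiv Submodule.topEquiv.symm)
  hom i := by
    by_cases hi : i < a + 1
    · have : Subsingleton (Fin (b i) → M) := by rw [h.b_zero i (by push_cast; omega)]; infer_instance
      refine ⟨0, fun c ↦ ⟨0, Subsingleton.elim _ _⟩, fun z ↦ ⟨fun _ ↦ ?_, fun _ ↦ rfl⟩⟩
      have : Subsingleton (truncFamily I (a + 1) i) := by
        rw [truncFamily_of_gt hi]
        infer_instance
      have hz : (z.1 : truncFamily I (a + 1) i) = 0 :=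
        Subsingleton.elim (α := truncFamily I (a + 1) i) _ _
      exact ⟨0, (map_zero _).trans hz.symm⟩
    · obtain ⟨f, hf, hk⟩ := h.hom i
      refine ⟨f ∘ₗ ((subcomplexInclusion i).restrict fun x hx ↦ (mem_cyc_subcomplex x).1 hx), hf.comp ?_, fun z ↦ ?_⟩
      · intro z
        exact ⟨⟨⟨z.1, cyc_le_truncFamily (by omega) z.2⟩, (mem_cyc_subcomplex _).2 z.2⟩, rfl⟩
      · rw [LinearMap.comp_apply, hk]
        constructor
        · rintro ⟨w, hw⟩
          refine ⟨⟨w, ?_⟩, Subtype.ext hw⟩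
          rw [truncFamily_of_lt (by omega)]
          trivial
        · rintro ⟨w, hw⟩
          exact ⟨w.1, congrArg Subtype.val hw⟩
  b_zero i hi := h.b_zero i (by push_cast; omega)
  b_ne := by
    have := h.b_ne
    rwa [show a + ((k + 1 : ℕ) : ℤ) = a + 1 + k by push_cast; ring] at this

/-- For an Ext-finite module of positive quasi-injective dimension `k + 1`, this dimension is
detected by any module of finite projective dimension which contains the residue field. -/
lemma not_extZero_of_minimal [IsNoetherianRing R] [IsLocalRing R] (hM : ExtFinite R M)
    (hk : HasQIR R M (k + 1)) (hmin : ∀ k', HasQIR R M k' → k + 1 ≤ k')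
    {F : Type u} [AddCommGroup F] [Module R F] {n : ℕ} (hF : ∀ j, n ≤ j → ExtZero R F M j)
    (f : (R ⧸ IsLocalRing.maximalIdeal R) →ₗ[R] F) (hf : Function.Injective f) :
    ¬ ExtZero R F M (k + 1) ∧ ∀ j, k + 1 < j → ExtZero R F M j := by
  have hvan : ∀ j, k + 1 < j → ExtZero R F M j := by
    -- Descending induction from degree `n`: a highest nonvanishing degree would be at most `k + 1`.
    have key : ∀ m j, n ≤ j + m → k + 1 < j → ExtZero R F M j := by
      intro m
      induction m with
      | zero => exact fun j hj _ ↦ hF j hj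
      | succ m ih =>
        intro j hj hkj
        by_contra h0
        exact absurd (hk.le_of_not_extZero (fun i hi ↦ ih i (by omega) (by omega)) h0) (by omega)
    exact fun j hj ↦ key n j (by omega) hj
  refine ⟨fun h0 ↦ ?_, hvan⟩
  obtain ⟨I, b, a, hI⟩ := hk
  have hFZ : ExtZero R F (cyc I (a + (k + 1 : ℕ))) (k + 1) := by
    refine (hI.extZero_of_le (Nat.succ_pos k) (fun j hj ↦ ?_) _).1 _ le_rfl
    rcases hj.lt_or_eq with hj | rfl
    · exact hvan j hj
    · exact h0
  -- `Ext^{k+2}(-, Z) = 0`, so `Ext^{k+1}(F, Z)` surjects onto `Ext^{k+1}` of the submodule.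
  have hkZ := hFZ.contra_sub hf (LinearMap.exact_map_mkQ_range f) (Submodule.mkQ_surjective _)
    (hI.extZero_cyc le_rfl rfl (Nat.lt_succ_self _))
  have hinj : Module.Injective R (cyc I (a + 1)) := by
    refine injective_of_extZero_one fun N _ _ _ ↦ ?_
    have h1 := extZero_of_extZero_residue (hI.extFinite_cyc hM _) (Nat.succ_pos k)
      (fun N _ _ ↦ hI.extZero_cyc le_rfl rfl (Nat.lt_succ_self _)) hkZ N
    have h2 := hI.extZero_cyc_of_le (l := k) le_rfl h1 (i := a + 1) (by
      rw [Nat.add_sub_cancel_left]; rfl)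
    rwa [Nat.add_sub_cancel_left] at h2
  exact absurd (hmin k ⟨_, _, _, hI.truncate hinj⟩) (by omega)

end Truncation

/-! ### Cones, giving resolutions of cosyzygies. -/

section Cosyzygy

variable {R : Type u} [CommRing R]

lemma extZero_succ_iff {A B C N : Type u} [AddCommGroup A] [Module R A] [AddCommGroup B]
    [Module R B] [AddCommGroup C] [Module R C] [AddCommGroup N] [Module R N] {f : A →ₗ[R] B}
    {g : B →ₗ[R] C} (hf : Function.Injective f) (hfg : Function.Exact f g)
    (hg : Function.Surjective g) [Module.Injective R B] (j : ℕ) :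
    ExtZero R N A (j + 2) ↔ ExtZero R N C (j + 1) :=
  ⟨fun h ↦ ExtZero.quotient hf hfg hg (extZero_of_injective j) h,
    fun h ↦ ExtZero.sub hf hfg hg h (extZero_of_injective _)⟩

instance Module.Injective.prod {A B : Type u} [AddCommGroup A] [Module R A] [AddCommGroup B]
    [Module R B] [Module.Injective R A] [Module.Injective R B] : Module.Injective R (A × B) where
  out X Y _ _ _ _ f hf g := by
    obtain ⟨h₁, hh₁⟩ := Module.Injective.out f hf (LinearMap.fst R A B ∘ₗ g)
    obtain ⟨h₂, hh₂⟩ := Module.Injective.out f hf (LinearMap.snd R A B ∘ₗ g)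
    exact ⟨h₁.prod h₂, fun x ↦ Prod.ext (hh₁ x) (hh₂ x)⟩

/-- A linear map that descends along a surjection. -/
lemma exists_descend {W X Y : Type*} [AddCommGroup W] [Module R W] [AddCommGroup X] [Module R X]
    [AddCommGroup Y] [Module R Y] (α : W →ₗ[R] X) (hα : Function.Surjective α) (β : W →ₗ[R] Y)
    (h : ∀ w, α w = 0 → β w = 0) : ∃ f : X →ₗ[R] Y, ∀ w, f (α w) = β w := by
  refine ⟨(LinearMap.ker α).liftQ β h ∘ₗ (α.quotKerEquivOfSurjective hα).symm.toLinearMap,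
    fun w ↦ ?_⟩
  have : (α.quotKerEquivOfSurjective hα).symm (α w) = Submodule.Quotient.mk w := by
    rw [LinearEquiv.symm_apply_eq]; rfl
  rw [LinearMap.comp_apply, LinearEquiv.coe_coe, this]
  rfl

variable {M E C : Type u} [AddCommGroup M] [Module R M] [AddCommGroup E] [Module R E]
  [AddCommGroup C] [Module R C]

variable (I : ChainComplex (ModuleCat.{u} R) ℤ) (b : ℤ → ℕ)
  (φ : ∀ i, I.X i →ₗ[R] (Fin (b i) → E))

/-- The differential of the mapping cone of a map from a complex `I` to a complex `E^{b_i}` with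
zero differentials. -/
noncomputable def coneZeroD (i : ℤ) :
    ModuleCat.of R (I.X (i + 1) × (Fin (b (i + 1 + 1)) → E)) ⟶
      ModuleCat.of R (I.X i × (Fin (b (i + 1)) → E)) :=
  ModuleCat.ofHom (((I.d (i + 1) i).hom ∘ₗ LinearMap.fst R _ _).prod
    (φ (i + 1) ∘ₗ LinearMap.fst R _ _))

/-- The mapping cone of a map `φ` from a complex `I` to a complex `E^{b_i}` with zero
differentials. -/
noncomputable def coneZero (hφ : ∀ i, ∀ x ∈ bdry I i, φ i x = 0) :
    ChainComplex (ModuleCat.{u} R) ℤ :=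
  ChainComplex.of (fun i ↦ ModuleCat.of R (I.X i × (Fin (b (i + 1)) → E))) (coneZeroD I b φ)
    (fun i ↦ by
      refine ModuleCat.hom_ext (LinearMap.ext fun x ↦ Prod.ext ?_ ?_)
      · exact d_d_apply _ _ _ _
      · exact hφ _ _ ⟨_, rfl⟩)

variable {I b φ}

lemma coneZero_d_apply (hφ : ∀ i, ∀ x ∈ bdry I i, φ i x = 0) (i : ℤ)
    (x : I.X (i + 1) × (Fin (b (i + 1 + 1)) → E)) :
    (coneZero I b φ hφ).d (i + 1) i x = (I.d (i + 1) i x.1, φ (i + 1) x.1) := by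
  have : (coneZero I b φ hφ).d (i + 1) i = coneZeroD I b φ i :=
    ChainComplex.of_d (fun i ↦ ModuleCat.of R (I.X i × (Fin (b (i + 1)) → E)))
      (coneZeroD I b φ) i
  rw [this]
  rfl

lemma mem_cyc_coneZero (hφ : ∀ i, ∀ x ∈ bdry I i, φ i x = 0) (i : ℤ)
    (x : I.X i × (Fin (b (i + 1)) → E)) :
    (show (coneZero I b φ hφ).X i from x) ∈ cyc (coneZero I b φ hφ) i ↔
      x.1 ∈ cyc I i ∧ φ i x.1 = 0 := by
  obtain ⟨j, rfl⟩ : ∃ j, i = j + 1 := ⟨i - 1, by omega⟩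
  rw [mem_cyc j rfl, mem_cyc j rfl, coneZero_d_apply hφ j x]
  exact Prod.ext_iff

/-- If `0 → M → E → C → 0` is exact with `E` injective, a bounded quasi-injective resolution of `M`
induces one of `C`. -/
lemma IsQIR.exists_coneZero [Nontrivial M] {a : ℤ} {k : ℕ} (h : IsQIR M I b a k) [Module.Injective R E]
    {ι : M →ₗ[R] E} {π : E →ₗ[R] C} (hι : Function.Injective ι) (hιπ : Function.Exact ι π)
    (hπ : Function.Surjective π) (a' : ℤ) (k' : ℕ) (ha : a' ≤ a) (hak : a' + k' + 1 = a + k) :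
    ∃ J : ChainComplex (ModuleCat.{u} R) ℤ, IsQIR C J (fun i ↦ b (i + 1)) a' k' := by
  choose f hf hk using h.hom
  have hE (n : ℕ) : Module.Injective R (Fin n → E) := inferInstance
  choose φ hφ using fun i ↦ (hE (b i)).out (cyc I i).subtype (Submodule.injective_subtype _)
    (ι.compLeft (Fin (b i)) ∘ₗ f i)
  have hιn (n : ℕ) : Function.Injective (ι.compLeft (Fin n)) := fun x y hxy ↦
    funext fun i ↦ hι (congrFun hxy i)
  -- `φ` extends `ι ∘ f` from cycles, so it is injective on homology; hence the cone only has the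
  -- cokernels `C^{b_{i+1}}` as homology.
  have hφ0 : ∀ i, ∀ x (hx : x ∈ cyc I i), φ i x = 0 ↔ x ∈ bdry I i := fun i x hx ↦ by
    have := hφ i ⟨x, hx⟩
    rw [Submodule.subtype_apply] at this
    rw [this, ← hk i ⟨x, hx⟩, LinearMap.comp_apply]
    exact (map_eq_zero_iff _ (hιn _))
  have hφB : ∀ i, ∀ x ∈ bdry I i, φ i x = 0 := fun i x hx ↦ (hφ0 i x (bdry_le_cyc I i hx)).2 hx
  refine ⟨coneZero I b φ hφB, ?_, ?_, ?_, ?_, ?_, ?_⟩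
  · obtain ⟨c, hc⟩ := h.above
    refine ⟨c, fun i hi ↦ ?_⟩
    have h1 := hc i hi
    have h2 := hc (i + 1) (by omega)
    have h3 : b (i + 1) = 0 := by
      by_contra h0
      have : Nonempty (Fin (b (i + 1))) := ⟨⟨0, by omega⟩⟩
      exact not_subsingleton (Fin (b (i + 1)) → M) (hf (i + 1)).subsingleton
    change Subsingleton (I.X i × (Fin (b (i + 1)) → E))
    rw [h3]
    infer_instance
  · intro i hi
    have := h.below i (by omega)
    change Subsingleton (I.X i × (Fin (b (i + 1)) → E))
    rw [h.b_zero (i + 1) (by omega)]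
    infer_instance
  · intro i
    change Module.Injective R (I.X i × (Fin (b (i + 1)) → E))
    have := h.inj i
    infer_instance
  · intro i
    -- `W` parametrises the cycles of the cone: the first entry of a cycle is a boundary `dw`. The
    -- class of `(dw, e)` is `π (e - φ w)`.
    let W := I.X (i + 1) × (Fin (b (i + 1)) → E)
    let α : W →ₗ[R] cyc (coneZero I b φ hφB) i :=
      LinearMap.codRestrict _ (M₂ := I.X i × (Fin (b (i + 1)) → E))
        (((I.d (i + 1) i).hom ∘ₗ LinearMap.fst R _ _).prod (LinearMap.snd R _ _))
        (fun x ↦ (mem_cyc_coneZero hφB i _).2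
          ⟨bdry_le_cyc I i ⟨_, rfl⟩, hφB _ _ ⟨_, rfl⟩⟩)
    let β : W →ₗ[R] (Fin (b (i + 1)) → C) :=
      π.compLeft _ ∘ₗ (LinearMap.snd R _ _ - φ (i + 1) ∘ₗ LinearMap.fst R _ _)
    have hα : Function.Surjective α := by
      rintro ⟨x, hx⟩
      obtain ⟨h1, h2⟩ := (mem_cyc_coneZero hφB i x).1 hx
      obtain ⟨w, hw⟩ := (hφ0 i _ h1).1 h2
      exact ⟨(w, x.2), Subtype.ext (Prod.ext hw rfl)⟩
    have hβ : Function.Surjective β := by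
      intro c
      choose e he using fun l ↦ hπ (c l)
      refine ⟨(0, e), funext fun l ↦ ?_⟩
      change π (e l - φ (i + 1) 0 l) = c l
      rw [map_zero, Pi.zero_apply, sub_zero, he]
    have hker : ∀ w, β w = 0 ↔ (α w : (coneZero I b φ hφB).X i) ∈ bdry (coneZero I b φ hφB) i := by
      rintro ⟨x, e⟩
      constructor
      · intro h0
        have h1 : ∀ l, ∃ m, ι m = e l - φ (i + 1) x l := fun l ↦ (hιπ _).1 (congrFun h0 l)
        choose m hm using h1
        obtain ⟨z, hz⟩ := hf (i + 1) m
        have h2 : φ (i + 1) z = e - φ (i + 1) x := by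
          have := hφ (i + 1) z
          rw [Submodule.subtype_apply] at this
          rw [this, LinearMap.comp_apply, hz]
          exact funext hm
        refine ⟨((x + z, 0) : I.X (i + 1) × (Fin (b (i + 1 + 1)) → E)), ?_⟩
        refine (coneZero_d_apply hφB i _).trans (Prod.ext ?_ ?_)
        · change I.d (i + 1) i (x + z.1) = I.d (i + 1) i x
          rw [map_add, (mem_cyc i rfl).1 z.2, add_zero]
        · change φ (i + 1) (x + z.1) = e
          rw [map_add, h2, add_sub_cancel]
      · rintro ⟨w, hw⟩
        have hw' := (coneZero_d_apply hφB i w).symm.trans hw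
        obtain ⟨h1, h2⟩ := Prod.ext_iff.1 hw'
        change I.d (i + 1) i w.1 = I.d (i + 1) i x at h1
        change φ (i + 1) w.1 = e at h2
        have hz : w.1 - x ∈ cyc I (i + 1) := (mem_cyc i rfl).2 (by rw [map_sub, h1, sub_self])
        have h3 := hφ (i + 1) ⟨_, hz⟩
        rw [Submodule.subtype_apply] at h3
        ext l
        change π (e l - φ (i + 1) x l) = 0
        rw [hιπ, ← h2, ← Pi.sub_apply, ← map_sub, h3]
        exact ⟨_, rfl⟩
    obtain ⟨g, hg⟩ := exists_descend α hα β fun w hw ↦ (hker w).2 (by rw [hw]; exact zero_mem _)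
    refine ⟨g, fun c ↦ ?_, fun z ↦ ?_⟩
    · obtain ⟨w, rfl⟩ := hβ c
      exact ⟨α w, hg w⟩
    · obtain ⟨w, rfl⟩ := hα z
      rw [hg, hker]
  · intro i hi
    exact h.b_zero (i + 1) (by omega)
  · have := h.b_ne
    rwa [← hak] at this

/-- For `k = 0` the cone acquires the new bottom term `E^{b_a}` in degree `a - 1`, which carries
homology. The length stays `0`, in accordance with truncated subtraction. -/
lemma HasQIR.cosyzygy [Nontrivial M] {k : ℕ} (h : HasQIR R M k) [Module.Injective R E]
    {ι : M →ₗ[R] E} {π : E →ₗ[R] C} (hι : Function.Injective ι) (hιπ : Function.Exact ι π)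
    (hπ : Function.Surjective π) : HasQIR R C (k - 1) := by
  obtain ⟨I, b, a, hI⟩ := h
  rcases Nat.eq_zero_or_pos k with rfl | hk
  · obtain ⟨J, hJ⟩ := hI.exists_coneZero hι hιπ hπ (a - 1) 0 (by omega) (by simp)
    exact ⟨J, _, _, hJ⟩
  · obtain ⟨J, hJ⟩ := hI.exists_coneZero hι hιπ hπ a (k - 1) le_rfl (by omega)
    exact ⟨J, _, _, hJ⟩

lemma IsQIR.congr {a : ℤ} {k : ℕ} (h : IsQIR M I b a k) (e : M ≃ₗ[R] C) : IsQIR C I b a k where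
  above := h.above
  below := h.below
  inj := h.inj
  hom i := by
    obtain ⟨f, hf, hk⟩ := h.hom i
    let e' := LinearEquiv.piCongrRight fun _ : Fin (b i) ↦ e
    refine ⟨e'.toLinearMap ∘ₗ f, e'.surjective.comp hf, fun z ↦ ?_⟩
    rw [← hk, LinearMap.comp_apply, LinearEquiv.coe_coe, LinearEquiv.map_eq_zero_iff]
  b_zero := h.b_zero
  b_ne := h.b_ne

lemma HasQIR.congr {k : ℕ} (h : HasQIR R M k) (e : M ≃ₗ[R] C) : HasQIR R C k := by
  obtain ⟨I, b, a, hI⟩ := h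
  exact ⟨I, b, a, hI.congr e⟩

end Cosyzygy

/-! ### Change of rings to `R/(y)`. -/

section Torsion

open scoped Pointwise

variable {R : Type u} [CommRing R] (y : R)

section

variable {A B C : Type*} [AddCommGroup A] [Module R A] [AddCommGroup B] [Module R B]
  [AddCommGroup C] [Module R C]

/-- The functor `Hom_R(R/(y), -)` on linear maps. -/
def torsionByMap (f : A →ₗ[R] B) :
    Submodule.torsionBy R A y →ₗ[R ⧸ Ideal.span {y}] Submodule.torsionBy R B y :=
  (f.restrict fun x hx ↦ by
    rw [Submodule.mem_torsionBy_iff] at hx ⊢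
    rw [← map_smul, hx, map_zero] :
    Submodule.torsionBy R A y →ₗ[R] Submodule.torsionBy R B y).extendScalarsOfSurjective
      Ideal.Quotient.mk_surjective

@[simp]
lemma coe_torsionByMap (f : A →ₗ[R] B) (x : Submodule.torsionBy R A y) :
    (torsionByMap y f x : B) = f x := rfl

variable {y} {f : A →ₗ[R] B} {g : B →ₗ[R] C}

lemma torsionByMap_injective (hf : Function.Injective f) :
    Function.Injective (torsionByMap y f) := fun _ _ h ↦
  Subtype.ext (hf (congrArg Subtype.val h))

lemma torsionByMap_exact (hf : Function.Injective f) (hfg : Function.Exact f g) :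
    Function.Exact (torsionByMap y f) (torsionByMap y g) := by
  intro x
  constructor
  · intro hx
    obtain ⟨a, ha⟩ := (hfg x.1).1 (congrArg Subtype.val hx)
    refine ⟨⟨a, ?_⟩, Subtype.ext ha⟩
    rw [Submodule.mem_torsionBy_iff]
    apply hf
    rw [map_smul, ha, map_zero]
    exact x.2
  · rintro ⟨a, rfl⟩
    exact Subtype.ext (hfg.apply_apply_eq_zero a.1)

/-- The obstruction to right exactness of `Hom_R(R/(y), -)` lies in `A/yA`, which vanishes for
divisible `A`. -/
lemma torsionByMap_surjective (hfg : Function.Exact f g) (hg : Function.Surjective g)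
    (hA : ∀ a : A, ∃ a', y • a' = a) : Function.Surjective (torsionByMap y g) := by
  rintro ⟨c, hc⟩
  obtain ⟨x, rfl⟩ := hg c
  rw [Submodule.mem_torsionBy_iff, ← map_smul] at hc
  obtain ⟨a, ha⟩ := (hfg _).1 hc
  obtain ⟨a', rfl⟩ := hA a
  refine ⟨⟨x - f a', ?_⟩, Subtype.ext ?_⟩
  · rw [Submodule.mem_torsionBy_iff, smul_sub, ← map_smul, ha, sub_self]
  · rw [coe_torsionByMap, map_sub, hfg.apply_apply_eq_zero, sub_zero]

end

/-- `Hom_R(R/(y), -)` is right adjoint to the exact restriction of scalars, so it preserves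
injectives. -/
lemma torsionBy_module_injective (E : Type u) [AddCommGroup E] [Module R E] [Module.Injective R E] :
    Module.Injective (R ⧸ Ideal.span {y}) (Submodule.torsionBy R E y) where
  out X Y _ _ _ _ f hf g := by
    let _ : Module R X := Module.compHom X (Ideal.Quotient.mk (Ideal.span {y}))
    let _ : Module R Y := Module.compHom Y (Ideal.Quotient.mk (Ideal.span {y}))
    have : IsScalarTower R (R ⧸ Ideal.span {y}) X := IsScalarTower.of_algebraMap_smul fun _ _ ↦ rfl
    have : IsScalarTower R (R ⧸ Ideal.span {y}) Y := IsScalarTower.of_algebraMap_smul fun _ _ ↦ rfl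
    obtain ⟨h, hh⟩ := Module.Injective.out (f.restrictScalars R) hf
      ((Submodule.torsionBy R E y).subtype ∘ₗ g.restrictScalars R)
    have hy (z : Y) : y • z = 0 := by
      change Ideal.Quotient.mk (Ideal.span {y}) y • z = 0
      rw [Ideal.Quotient.eq_zero_iff_mem.2 (Ideal.mem_span_singleton_self y), zero_smul]
    refine ⟨(h.codRestrict (Submodule.torsionBy R E y) fun z ↦ by
      rw [Submodule.mem_torsionBy_iff, ← map_smul, hy, map_zero]).extendScalarsOfSurjective
        Ideal.Quotient.mk_surjective, fun x ↦ Subtype.ext (hh x)⟩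

variable {y}

lemma exists_smul_eq_of_injective (hy : IsSMulRegular R y) {E : Type u} [AddCommGroup E]
    [Module R E] [Module.Injective R E] (e : E) : ∃ e', y • e' = e := by
  obtain ⟨h, hh⟩ := Module.Injective.out (LinearMap.lsmul R R y) hy (LinearMap.toSpanSingleton R E e)
  refine ⟨h 1, ?_⟩
  have := hh 1
  rw [LinearMap.toSpanSingleton_apply, one_smul, LinearMap.lsmul_apply] at this
  rw [← map_smul, this]

variable {F : Type u} [AddCommGroup F] [Module R F] [Module (R ⧸ Ideal.span {y}) F]
  [IsScalarTower R (R ⧸ Ideal.span {y}) F]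

variable (y F) in
lemma smul_eq_zero_of_isScalarTower (x : F) : y • x = 0 := by
  rw [← one_smul (R ⧸ Ideal.span {y}) x, ← smul_assoc, Algebra.smul_def, mul_one,
    Ideal.Quotient.algebraMap_eq,
    Ideal.Quotient.eq_zero_iff_mem.2 (Ideal.mem_span_singleton_self y), zero_smul]

lemma lift_torsionBy_iff {B C : Type u} [AddCommGroup B] [Module R B]
    [AddCommGroup C] [Module R C] (g : B →ₗ[R] C) :
    (∀ l : F →ₗ[R ⧸ Ideal.span {y}] Submodule.torsionBy R C y,
      ∃ h : F →ₗ[R ⧸ Ideal.span {y}] Submodule.torsionBy R B y, torsionByMap y g ∘ₗ h = l) ↔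
    ∀ l : F →ₗ[R] C, ∃ h : F →ₗ[R] B, g ∘ₗ h = l := by
  constructor
  · intro H l
    obtain ⟨h, hh⟩ := H ((l.codRestrict (Submodule.torsionBy R C y) fun z ↦ by
      rw [Submodule.mem_torsionBy_iff, ← map_smul, smul_eq_zero_of_isScalarTower y F,
        map_zero]).extendScalarsOfSurjective Ideal.Quotient.mk_surjective)
    exact ⟨(Submodule.torsionBy R B y).subtype ∘ₗ h.restrictScalars R,
      LinearMap.ext fun x ↦ congrArg Subtype.val (LinearMap.congr_fun hh x)⟩
  · intro H l
    obtain ⟨h, hh⟩ := H ((Submodule.torsionBy R C y).subtype ∘ₗ l.restrictScalars R)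
    refine ⟨(h.codRestrict (Submodule.torsionBy R B y) fun z ↦ by
      rw [Submodule.mem_torsionBy_iff, ← map_smul, smul_eq_zero_of_isScalarTower y F,
        map_zero]).extendScalarsOfSurjective Ideal.Quotient.mk_surjective,
      LinearMap.ext fun x ↦ Subtype.ext (LinearMap.congr_fun hh x)⟩

/-- Every module embeds into an injective module. -/
lemma exists_exact_injective (M : Type u) [AddCommGroup M] [Module R M] :
    ∃ (E C : Type u) (_ : AddCommGroup E) (_ : Module R E) (_ : AddCommGroup C) (_ : Module R C)
      (f : M →ₗ[R] E) (g : E →ₗ[R] C), Module.Injective R E ∧ Function.Injective f ∧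
      Function.Exact f g ∧ Function.Surjective g := by
  let f := (Injective.ι (ModuleCat.of R M)).hom
  refine ⟨(Injective.under (ModuleCat.of R M) : ModuleCat.{u} R), _ ⧸ LinearMap.range f,
    inferInstance, inferInstance, inferInstance, inferInstance, f, Submodule.mkQ _, ?_, ?_, LinearMap.exact_map_mkQ_range f,
    Submodule.mkQ_surjective _⟩
  · have : Injective (Injective.under (ModuleCat.of R M)) := inferInstance
    exact Module.injective_module_of_injective_object R _
  · exact (ModuleCat.mono_iff_injective _).1 inferInstance

/-- For a `y`-divisible module `D`, vanishing of `Ext_R(F, D)` and of `Ext_{R/(y)}(F, Hom(R/(y), D))`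
are equivalent. -/
lemma extZero_torsionBy_iff (hy : IsSMulRegular R y) {D : Type u} [AddCommGroup D] [Module R D]
    (hD : ∀ d : D, ∃ d', y • d' = d) (j : ℕ) :
    ExtZero (R ⧸ Ideal.span {y}) F (Submodule.torsionBy R D y) (j + 1) ↔
      ExtZero R F D (j + 1) := by
  induction j generalizing D with
  | zero =>
    obtain ⟨E, C, _, _, _, _, f, g, _, hf, hfg, hg⟩ := exists_exact_injective (R := R) D
    have := torsionBy_module_injective y E
    rw [zero_add, extZero_one_iff_lift hf hfg hg, extZero_one_iff_lift (torsionByMap_injective hf)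
      (torsionByMap_exact hf hfg) (torsionByMap_surjective hfg hg hD), lift_torsionBy_iff]
  | succ j ih =>
    obtain ⟨E, C, _, _, _, _, f, g, _, hf, hfg, hg⟩ := exists_exact_injective (R := R) D
    have := torsionBy_module_injective y E
    rw [extZero_succ_iff hf hfg hg, extZero_succ_iff (torsionByMap_injective hf)
      (torsionByMap_exact hf hfg) (torsionByMap_surjective hfg hg hD)]
    refine ih fun c ↦ ?_
    obtain ⟨e, rfl⟩ := hg c
    obtain ⟨e', rfl⟩ := exists_smul_eq_of_injective hy e
    exact ⟨g e', (map_smul _ _ _).symm⟩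

/-- Rees' change of rings: `Ext^j_{R/(y)}(F, M/yM)` vanishes if and only if `Ext^{j+1}_R(F, M)`
does. -/
lemma extZero_quotSMulTop_iff (hy : IsSMulRegular R y) {M : Type u} [AddCommGroup M] [Module R M]
    (hM : IsSMulRegular M y) (j : ℕ) :
    ExtZero (R ⧸ Ideal.span {y}) F (QuotSMulTop y M) (j + 1) ↔ ExtZero R F M (j + 2) := by
  obtain ⟨E, C, _, _, _, _, f, g, _, hf, hfg, hg⟩ := exists_exact_injective (R := R) M
  have := torsionBy_module_injective y E
  rw [extZero_succ_iff hf hfg hg, ← extZero_torsionBy_iff hy (fun c ↦ by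
    obtain ⟨e, rfl⟩ := hg c
    obtain ⟨e', rfl⟩ := exists_smul_eq_of_injective hy e
    exact ⟨g e', (map_smul _ _ _).symm⟩)]
  -- The snake lemma for multiplication by `y` gives `0 → E[y] → C[y] → M/yM → 0`, as `M[y] = 0` and
  -- `E = yE`. The connecting map `δ` sends `g w` to the class of `f⁻¹(y w)`, and `E[y]` is
  -- injective over `R/(y)`.
  let W : Submodule R E := (LinearMap.range f).comap (LinearMap.lsmul R E y)
  let α : W →ₗ[R] Submodule.torsionBy R C y := g.restrict fun w hw ↦ by
    rw [Submodule.mem_torsionBy_iff, ← map_smul]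
    obtain ⟨m, hm⟩ := hw
    exact (hfg _).2 ⟨m, hm⟩
  let β : W →ₗ[R] QuotSMulTop y M := Submodule.mkQ _ ∘ₗ (LinearEquiv.ofInjective f hf).symm ∘ₗ
    (LinearMap.lsmul R E y).restrict (p := W) (q := LinearMap.range f) fun w hw ↦ hw
  have hβ (w : W) (m : M) (hm : f m = y • (w : E)) : β w = Submodule.Quotient.mk m := by
    have : (LinearEquiv.ofInjective f hf).symm
        ((LinearMap.lsmul R E y).restrict (p := W) (q := LinearMap.range f) (fun w hw ↦ hw) w) = m := by
      rw [LinearEquiv.symm_apply_eq]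
      exact Subtype.ext hm.symm
    exact congrArg Submodule.Quotient.mk this
  have hα : Function.Surjective α := by
    rintro ⟨c, hc⟩
    obtain ⟨e, rfl⟩ := hg c
    refine ⟨⟨e, ?_⟩, rfl⟩
    rw [Submodule.mem_torsionBy_iff, ← map_smul] at hc
    exact (hfg _).1 hc
  have hker (w : W) : α w = 0 ↔ ∃ m, f m = w := by
    rw [← Set.mem_range, ← hfg]
    exact Subtype.ext_iff
  obtain ⟨δ, hδ⟩ := exists_descend α hα β fun w hw ↦ by
    obtain ⟨m, hm⟩ := (hker w).1 hw
    rw [hβ w (y • m) (by rw [map_smul, hm]), Submodule.Quotient.mk_eq_zero]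
    exact Submodule.smul_mem_pointwise_smul m y ⊤ trivial
  let δ' := δ.extendScalarsOfSurjective (S := R ⧸ Ideal.span {y}) Ideal.Quotient.mk_surjective
  have hinj : Function.Injective (torsionByMap y g) := by
    rw [injective_iff_map_eq_zero]
    intro e he
    obtain ⟨m, hm⟩ := (hfg _).1 (congrArg Subtype.val he)
    have h0 : y • m = 0 := hf (by rw [map_smul, hm, map_zero]; exact e.2)
    have : m = 0 := hM (by simpa using h0)
    exact Subtype.ext (hm.symm.trans (by rw [this, map_zero]; rfl))
  have hexact : Function.Exact (torsionByMap y g) δ' := by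
    intro c
    obtain ⟨w, rfl⟩ := hα c
    change δ (α w) = 0 ↔ _
    obtain ⟨m, hm⟩ := w.2
    rw [hδ, hβ w m hm, Submodule.Quotient.mk_eq_zero, Submodule.mem_smul_pointwise_iff_exists]
    constructor
    · rintro ⟨m', -, rfl⟩
      refine ⟨⟨w - f m', ?_⟩, Subtype.ext ?_⟩
      · rw [Submodule.mem_torsionBy_iff, smul_sub, ← map_smul, hm]
        exact sub_self _
      · change g (w - f m') = g w
        rw [map_sub, hfg.apply_apply_eq_zero, sub_zero]
    · rintro ⟨e, he⟩
      have he' : g e = g w := congrArg Subtype.val he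
      obtain ⟨m', hm'⟩ := (hfg (w - e)).1 (by rw [map_sub, he', sub_self])
      refine ⟨m', trivial, hf ?_⟩
      have h0 : y • (e : E) = 0 := e.2
      rw [map_smul, hm', smul_sub, h0, sub_zero]
      exact hm.symm
  have hsurj : Function.Surjective δ' := by
    intro m
    obtain ⟨m, rfl⟩ := Submodule.mkQ_surjective _ m
    obtain ⟨e, he⟩ := exists_smul_eq_of_injective hy (f m)
    exact ⟨α ⟨e, m, he.symm⟩, (hδ _).trans (hβ _ m he.symm)⟩
  exact ⟨fun h ↦ (extZero_of_injective j).extension hinj hexact hsurj h,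
    fun h ↦ ExtZero.quotient hinj hexact hsurj h (extZero_of_injective (j + 1))⟩

variable {M : Type u} [AddCommGroup M] [Module R M]

variable (y) in
/-- The complex `Hom_R(R/(y), I)`. -/
noncomputable def ChainComplex.torsion (I : ChainComplex (ModuleCat.{u} R) ℤ) :
    ChainComplex (ModuleCat.{u} (R ⧸ Ideal.span {y})) ℤ where
  X i := ModuleCat.of _ (Submodule.torsionBy R (I.X i) y)
  d i j := ModuleCat.ofHom (torsionByMap y (I.d i j).hom)
  shape i j hij := by
    refine ModuleCat.hom_ext (LinearMap.ext fun x ↦ Subtype.ext ?_)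
    change I.d i j x.1 = 0
    rw [I.shape i j hij]
    rfl
  d_comp_d' i j k _ _ := by
    refine ModuleCat.hom_ext (LinearMap.ext fun x ↦ Subtype.ext ?_)
    exact d_d_apply i j k x.1

variable {I : ChainComplex (ModuleCat.{u} R) ℤ} {b : ℤ → ℕ} {a : ℤ} {k : ℕ}

lemma mem_cyc_torsion {i : ℤ} (x : Submodule.torsionBy R (I.X i) y) :
    (show (I.torsion y).X i from x) ∈ cyc (I.torsion y) i ↔ (x : I.X i) ∈ cyc I i :=
  Subtype.ext_iff

/-- The homology of `Hom_R(R/(y), I)` in degree `i` is assembled from `Hom(R/(y), H_i)`, zero since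
`y` is regular on `M`, and `Ext^1(R/(y), H_{i+1})`, a power of `M/yM`. -/
lemma IsQIR.exists_cyc_torsion (h : IsQIR M I b a k) (hy : IsSMulRegular R y)
    (hM : IsSMulRegular M y) (i : ℤ) :
    ∃ f : cyc (I.torsion y) i →ₗ[R ⧸ Ideal.span {y}] (Fin (b (i + 1)) → QuotSMulTop y M),
      Function.Surjective f ∧
      ∀ z, f z = 0 ↔ (z : (I.torsion y).X i) ∈ bdry (I.torsion y) i := by
  have := h.inj
  obtain ⟨f, hf, hk⟩ := h.hom (i + 1)
  obtain ⟨f₀, -, hk₀⟩ := h.hom i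
  let _ : Module R ((I.torsion y).X i) :=
    inferInstanceAs (Module R (Submodule.torsionBy R (I.X i) y))
  have : IsScalarTower R (R ⧸ Ideal.span {y}) ((I.torsion y).X i) :=
    inferInstanceAs (IsScalarTower R (R ⧸ Ideal.span {y}) (Submodule.torsionBy R (I.X i) y))
  -- For `w` with `y w` a cycle, the torsion cycle `dw` corresponds to the class of `f (y w)` modulo
  -- `y`. Every torsion cycle is such a `dw`, because its homology class is `y`-torsion.
  let W : Submodule R (I.X (i + 1)) := (cyc I (i + 1)).comap (LinearMap.lsmul R _ y)
  have hW (w : W) : y • I.d (i + 1) i w = 0 := by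
    rw [← map_smul]
    exact (mem_cyc i rfl).1 w.2
  let α : W →ₗ[R] cyc (I.torsion y) i :=
    { toFun w := ⟨⟨I.d (i + 1) i w, hW w⟩, (mem_cyc_torsion _).2 (bdry_le_cyc I i ⟨_, rfl⟩)⟩
      map_add' w w' := Subtype.ext (Subtype.ext (map_add _ _ _))
      map_smul' r w := Subtype.ext (Subtype.ext (map_smul (I.d (i + 1) i).hom _ _)) }
  let β : W →ₗ[R] (Fin (b (i + 1)) → QuotSMulTop y M) :=
    (Submodule.mkQ (y • (⊤ : Submodule R M))).compLeft _ ∘ₗ f ∘ₗ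
      (LinearMap.lsmul R _ y).restrict (p := W) (q := cyc I (i + 1)) fun w hw ↦ hw
  have hα : Function.Surjective α := by
    rintro ⟨⟨z, hz⟩, hz'⟩
    have hzc := (mem_cyc_torsion _).1 hz'
    have h0 : f₀ ⟨z, hzc⟩ = 0 := by
      have h1 : y • f₀ ⟨z, hzc⟩ = 0 := by
        rw [← map_smul]
        have : y • (⟨z, hzc⟩ : cyc I i) = 0 := Subtype.ext hz
        rw [this, map_zero]
      exact funext fun l ↦ hM (by simpa using congrFun h1 l)
    obtain ⟨w, hw⟩ := (hk₀ _).1 h0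
    refine ⟨⟨w, ?_⟩, Subtype.ext (Subtype.ext hw)⟩
    refine (mem_cyc i rfl).2 ?_
    change (I.d (i + 1) i).hom (y • w) = 0
    rw [map_smul, hw]
    exact hz
  have hβ : Function.Surjective β := by
    intro m
    choose m' hm' using fun l ↦ Submodule.mkQ_surjective _ (m l)
    obtain ⟨z, hz⟩ := hf m'
    obtain ⟨w, hw⟩ := exists_smul_eq_of_injective hy (z : I.X (i + 1))
    refine ⟨⟨w, ?_⟩, ?_⟩
    · change y • w ∈ cyc I (i + 1)
      rw [hw]
      exact z.2
    · have : (LinearMap.lsmul R _ y).restrict (p := W) (q := cyc I (i + 1)) (fun w hw ↦ hw)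
          (⟨w, by change y • w ∈ cyc I (i + 1); rw [hw]; exact z.2⟩ : W) = z := Subtype.ext hw
      change (fun l ↦ Submodule.mkQ _ (f _ l)) = m
      rw [this, hz]
      exact funext hm'
  have hβ0 (w : W) : β w = 0 ↔ ∃ z : cyc I (i + 1), y • f z = f ⟨y • (w : I.X (i + 1)), w.2⟩ := by
    constructor
    · intro h0
      have h1 : ∀ l, ∃ m, y • m = f ⟨y • (w : I.X (i + 1)), w.2⟩ l := fun l ↦ by
        have := (Submodule.Quotient.mk_eq_zero _).1 (congrFun h0 l)
        obtain ⟨m, -, hm⟩ := (Submodule.mem_smul_pointwise_iff_exists _ _ _).1 this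
        exact ⟨m, hm⟩
      choose m hm using h1
      obtain ⟨z, rfl⟩ := hf m
      exact ⟨z, funext hm⟩
    · rintro ⟨z, hz⟩
      funext l
      refine (Submodule.Quotient.mk_eq_zero _).2 ?_
      exact (Submodule.mem_smul_pointwise_iff_exists _ _ _).2 ⟨f z l, trivial, congrFun hz l⟩
  have hker : ∀ w, β w = 0 ↔ (α w : (I.torsion y).X i) ∈ bdry (I.torsion y) i := by
    intro w
    rw [hβ0]
    constructor
    · rintro ⟨z, hz⟩
      have h0 : f (⟨y • (w : I.X (i + 1)), w.2⟩ - y • z) = 0 := by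
        rw [map_sub, map_smul, hz, sub_self]
      obtain ⟨v, hv⟩ := (hk _).1 h0
      obtain ⟨v', rfl⟩ := exists_smul_eq_of_injective hy v
      have hv' : y • (I.d (i + 1 + 1) (i + 1)).hom v' = y • (w : I.X (i + 1)) - y • (z : I.X (i + 1)) := by
        rw [← map_smul]
        exact hv
      refine ⟨⟨(w : I.X (i + 1)) - z - (I.d (i + 1 + 1) (i + 1)).hom v', ?_⟩, Subtype.ext ?_⟩
      · rw [Submodule.mem_torsionBy_iff, smul_sub, hv', smul_sub, sub_self]
      · change (I.d (i + 1) i).hom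
          ((w : I.X (i + 1)) - z - (I.d (i + 1 + 1) (i + 1)).hom v') = I.d (i + 1) i w
        have h1 : (I.d (i + 1) i).hom ((I.d (i + 1 + 1) (i + 1)).hom v') = 0 := d_d_apply _ _ _ _
        have h2 : (I.d (i + 1) i).hom z.1 = 0 := (mem_cyc i rfl).1 z.2
        rw [map_sub, map_sub, h1, h2, sub_zero, sub_zero]
    · rintro ⟨v, hv⟩
      have hv' : (I.d (i + 1) i).hom v.1 = (I.d (i + 1) i).hom w.1 := congrArg Subtype.val hv
      have hz : w.1 - v.1 ∈ cyc I (i + 1) := (mem_cyc i rfl).2 (by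
        change (I.d (i + 1) i).hom _ = 0
        rw [map_sub, hv', sub_self])
      refine ⟨⟨_, hz⟩, ?_⟩
      rw [← map_smul]
      congr 1
      refine Subtype.ext ?_
      have h0 : y • (v.1 : I.X (i + 1)) = 0 := v.2
      change y • (w.1 - v.1) = y • w.1
      rw [smul_sub, h0, sub_zero]
  obtain ⟨g, hg⟩ := exists_descend α hα β fun w hw ↦ (hker w).2 (by rw [hw]; exact zero_mem _)
  refine ⟨g.extendScalarsOfSurjective Ideal.Quotient.mk_surjective, fun c ↦ ?_, fun z ↦ ?_⟩
  · obtain ⟨w, rfl⟩ := hβ c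
    exact ⟨α w, hg w⟩
  · obtain ⟨w, rfl⟩ := hα z
    change g (α w) = 0 ↔ _
    rw [hg, hker]

lemma IsQIR.torsion (h : IsQIR M I b a (k + 1)) (hy : IsSMulRegular R y)
    (hM : IsSMulRegular M y) :
    IsQIR (QuotSMulTop y M) (I.torsion y) (fun i ↦ b (i + 1)) a k where
  above := by
    obtain ⟨c, hc⟩ := h.above
    refine ⟨c, fun i hi ↦ ?_⟩
    have := hc i hi
    change Subsingleton (Submodule.torsionBy R (I.X i) y)
    infer_instance
  below i hi := by
    have := h.below i hi
    change Subsingleton (Submodule.torsionBy R (I.X i) y)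
    infer_instance
  inj i := by
    have := h.inj i
    exact torsionBy_module_injective y (I.X i)
  hom := h.exists_cyc_torsion hy hM
  b_zero i hi := h.b_zero (i + 1) (by push_cast; omega)
  b_ne := by
    have := h.b_ne
    rwa [show a + ((k + 1 : ℕ) : ℤ) = a + k + 1 by push_cast; ring] at this

lemma HasQIR.quotSMulTop (h : HasQIR R M (k + 1)) (hy : IsSMulRegular R y)
    (hM : IsSMulRegular M y) : HasQIR (R ⧸ Ideal.span {y}) (QuotSMulTop y M) k := by
  obtain ⟨I, b, a, hI⟩ := h
  exact ⟨_, _, _, hI.torsion hy hM⟩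

/-- A module of quasi-injective dimension zero is divisible by regular elements. -/
lemma HasQIR.subsingleton_quotSMulTop (h : HasQIR R M 0) (hy : IsSMulRegular R y) :
    Subsingleton (QuotSMulTop y M) := by
  obtain ⟨I, b, a, hI⟩ := h
  have := hI.inj a
  obtain ⟨f, hf, -⟩ := hI.hom a
  have hb : b a ≠ 0 := by simpa using hI.b_ne
  refine ⟨fun m m' ↦ ?_⟩
  have key (m : QuotSMulTop y M) : m = 0 := by
    obtain ⟨m, rfl⟩ := Submodule.mkQ_surjective _ m
    obtain ⟨z, hz⟩ := hf fun _ ↦ m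
    obtain ⟨w, hw⟩ := exists_smul_eq_of_injective hy (z : I.X a)
    have hwc : w ∈ cyc I a := by rw [hI.cyc_eq_top]; trivial
    have : z = y • ⟨w, hwc⟩ := Subtype.ext hw.symm
    rw [this, map_smul] at hz
    refine (Submodule.Quotient.mk_eq_zero _).2
      ((Submodule.mem_smul_pointwise_iff_exists _ _ _).2 ⟨_, trivial, congrFun hz ⟨0, by omega⟩⟩)
  rw [key m, key m']

end Torsion

/-! ### Matching the upper and lower bounds. -/

section Final

lemma EReal.max_natCast_sub_natCast (k n : ℕ) :
    max ((k : EReal) - (n : EReal)) 0 = ((k - n : ℕ) : EReal) := by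
  have h : (k : EReal) - (n : EReal) = (((k : ℝ) - (n : ℝ) : ℝ) : EReal) := by
    rw [EReal.coe_sub]; rfl
  have h0 : ((k - n : ℕ) : EReal) = (((k - n : ℕ) : ℝ) : EReal) := rfl
  rw [h, h0, ← EReal.coe_zero]
  rcases le_total n k with hle | hle
  · rw [Nat.cast_sub hle, max_eq_left (EReal.coe_le_coe_iff.2 (by simpa using hle))]
  · rw [Nat.sub_eq_zero_of_le hle, Nat.cast_zero,
      max_eq_right (EReal.coe_le_coe_iff.2 (by simpa using hle))]

variable {R : Type u} [CommRing R] {M : Type u} [AddCommGroup M] [Module R M]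

lemma HasQIR.qid_eq [Nontrivial M] {k : ℕ} (h : HasQIR R M k)
    (hmin : ∀ k', HasQIR R M k' → k ≤ k') : qid R M = (k : EReal) :=
  le_antisymm h.qid_le (le_qid hmin)

lemma hasQIR_quotSMulTop_min [IsNoetherianRing R] [IsLocalRing R] (hM : ExtFinite R M) {k : ℕ}
    (hk : HasQIR R M (k + 1)) (hmin : ∀ k', HasQIR R M k' → k + 1 ≤ k') {y : R}
    (hym : y ∈ IsLocalRing.maximalIdeal R) (hy : IsSMulRegular R y) (hyM : IsSMulRegular M y)
    {l : ℕ} (hl : HasQIR (R ⧸ Ideal.span {y}) (QuotSMulTop y M) l) : k ≤ l := by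
  obtain ⟨J, hyJ, ⟨n, hn⟩, f, hf⟩ := exists_ideal_extZero_residue R hym (Or.inr hy)
  obtain ⟨h1, h2⟩ := not_extZero_of_minimal hM hk hmin (fun j hj ↦ hn j hj M) f hf
  have htors : Module.IsTorsionBySet R (R ⧸ J) (Ideal.span {y} : Ideal R) := by
    rintro x ⟨r, hr⟩
    obtain ⟨x, rfl⟩ := Submodule.mkQ_surjective _ x
    refine (Submodule.Quotient.mk_eq_zero J).2 (Ideal.mul_mem_right _ J ?_)
    exact (Ideal.span_singleton_le_iff_mem J).2 hyJ hr
  let _ : Module (R ⧸ Ideal.span {y}) (R ⧸ J) := htors.module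
  have : IsScalarTower R (R ⧸ Ideal.span {y}) (R ⧸ J) := htors.isScalarTower
  -- The comparison of Ext groups starts at `Ext^1` over `R/(y)`; for `k = 0` the bound is trivial.
  rcases k with _ | k
  · exact Nat.zero_le _
  refine hl.le_of_not_extZero (F := R ⧸ J) (fun j hj ↦ ?_) fun h ↦ h1 ?_
  · obtain ⟨j, rfl⟩ := Nat.exists_eq_add_of_le' (show 1 ≤ j by omega)
    exact (extZero_quotSMulTop_iff hy hyM j).2 (h2 _ (by omega))
  · exact (extZero_quotSMulTop_iff hy hyM k).1 h

variable {X : ModuleCat.{u} R} (J : InjectiveResolution X)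

lemma cosyzygy_eq_ker (n : ℕ) :
    cosyzygy J n = LinearMap.ker (J.cocomplex.d n (n + 1)).hom := by
  cases n with
  | zero => exact J.exact₀.moduleCat_range_eq_ker
  | succ n => exact (J.exact_succ n).moduleCat_range_eq_ker

lemma exact_cosyzygy (n : ℕ) : Function.Exact (cosyzygy J n).subtype
    ((J.cocomplex.d n (n + 1)).hom.rangeRestrict : _ →ₗ[R] cosyzygy J (n + 1)) := by
  intro x
  have : x ∈ Set.range (cosyzygy J n).subtype ↔ x ∈ cosyzygy J n := by simp
  rw [this, cosyzygy_eq_ker]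
  exact Subtype.ext_iff

lemma injective_cocomplex_X (n : ℕ) : Module.Injective R (J.cocomplex.X n) :=
  have := J.injective n
  Module.injective_module_of_injective_object R _

/-- The augmentation identifies a module with its zeroth cosyzygy. -/
noncomputable def equivCosyzygyZero : X ≃ₗ[R] cosyzygy J 0 :=
  LinearEquiv.ofInjective (J.ι.f 0).hom ((ModuleCat.mono_iff_injective _).1 inferInstance)

/-- The envelope of zero is zero. This keeps all earlier cosyzygies nonzero, as each cone step
requires. -/
lemma cosyzygy_ne_bot_of_succ (hJ : IsMinimalInjectiveResolution J) {n : ℕ}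
    (h : cosyzygy J (n + 1) ≠ ⊥) : cosyzygy J n ≠ ⊥ := by
  intro h0
  have htop := hJ n ⊤ (by rw [h0, inf_bot_eq])
  refine h (LinearMap.range_eq_bot.2 (LinearMap.ext fun x ↦ ?_))
  have hx : x = 0 := by
    rw [← Submodule.mem_bot R, ← htop]
    trivial
  rw [hx, map_zero, map_zero]

lemma hasQIR_cosyzygy {k : ℕ} (hk : HasQIR R X k) (hJ : IsMinimalInjectiveResolution J) (n : ℕ)
    (h : cosyzygy J n ≠ ⊥) : HasQIR R (cosyzygy J n) (k - n) := by
  induction n with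
  | zero => exact hk.congr (equivCosyzygyZero J)
  | succ n ih =>
    have h0 := cosyzygy_ne_bot_of_succ J hJ h
    have := Submodule.nontrivial_iff_ne_bot.2 h0
    have := injective_cocomplex_X J n
    exact (ih h0).cosyzygy (Submodule.injective_subtype _) (exact_cosyzygy J n)
      (LinearMap.surjective_rangeRestrict _)

lemma extZero_cosyzygy_iff {F : Type u} [AddCommGroup F] [Module R F] (n j : ℕ) :
    ExtZero R F (cosyzygy J n) (j + 1) ↔ ExtZero R F X (j + n + 1) := by
  induction n generalizing j with
  | zero => exact ⟨fun h ↦ h.congr (equivCosyzygyZero J), fun h ↦ h.congr (equivCosyzygyZero J).symm⟩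
  | succ n ih =>
    have := injective_cocomplex_X J n
    have h := extZero_succ_iff (N := F) (Submodule.injective_subtype _) (exact_cosyzygy J n)
      (LinearMap.surjective_rangeRestrict _) j
    refine h.symm.trans ((ih (j + 1)).trans ?_)
    rw [show j + 1 + n + 1 = j + (n + 1) + 1 by omega]

end Final

theorem proposition3p5 {R : Type u} [CommRing R] [IsNoetherianRing R] [IsLocalRing R]
    {M : Type u} [AddCommGroup M] [Module R M] [Nontrivial M]
    (hExt : ExtFinite R M) (hqid : qid R M < ⊤) :
    (∀ y ∈ IsLocalRing.maximalIdeal R, IsSMulRegular R y → IsSMulRegular M y →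
      Nontrivial (QuotSMulTop y M) →
      qid (R ⧸ Ideal.span {y}) (QuotSMulTop y M) = max (qid R M - 1) 0) ∧
    (∀ J : InjectiveResolution (ModuleCat.of R M), IsMinimalInjectiveResolution J →
      ∀ n : ℕ, cosyzygy J n ≠ ⊥ →
      qid R (cosyzygy J n) = max (qid R M - n) 0) := by
  obtain ⟨k, hk, hq, hmin⟩ := exists_hasQIR_of_qid_lt_top hqid
  constructor
  · intro y hym hy hyM hnt
    rcases k with _ | k
    · exact absurd (hq.subsingleton_quotSMulTop hy) (not_subsingleton _)
    have h1 : max (qid R M - 1) 0 = (k : EReal) := by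
      simpa [hk] using EReal.max_natCast_sub_natCast (k + 1) 1
    rw [h1]
    exact (hq.quotSMulTop hy hyM).qid_eq fun l hl ↦
      hasQIR_quotSMulTop_min hExt hq hmin hym hy hyM hl
  · intro J hJ n hn
    have := Submodule.nontrivial_iff_ne_bot.2 hn
    rw [hk, EReal.max_natCast_sub_natCast]
    refine (hasQIR_cosyzygy J hq hJ n hn).qid_eq fun l hl ↦ ?_
    obtain ⟨j, hj⟩ | hle : (∃ j, k = j + n + 1) ∨ k ≤ n := by
      by_cases h : k ≤ n
      · exact Or.inr h
      · exact Or.inl ⟨k - n - 1, by omega⟩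
    · subst hj
      -- No change of rings occurs here, so the test module is taken with `y = 0`.
      obtain ⟨I, -, ⟨m, hm⟩, f, hf⟩ :=
        exists_ideal_extZero_residue R (zero_mem (IsLocalRing.maximalIdeal R)) (Or.inl rfl)
      obtain ⟨h1, h2⟩ := not_extZero_of_minimal hExt hq hmin (fun i hi ↦ hm i hi M) f hf
      have : j + n + 1 - n = j + 1 := by omega
      rw [this]
      refine hl.le_of_not_extZero (F := R ⧸ I) (fun i hi ↦ ?_) fun h ↦ h1 ?_
      · obtain ⟨i, rfl⟩ := Nat.exists_eq_add_of_le' (show 1 ≤ i by omega)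
        exact (extZero_cosyzygy_iff J n i).2 (h2 _ (by omega))
      · exact (extZero_cosyzygy_iff J n j).1 h
    · rw [Nat.sub_eq_zero_of_le hle]
      exact Nat.zero_le _
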